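/- Let $\mathbf k$ be a field. Write $\mathbf{Pr}$ for the world of compactly generated presentable (i.e. locally finitely presentable) $\mathbf k$-linear categories. A tensor category in $\mathbf{Pr}$ is such a category with a monoidal structure whose tensor product is $\mathbf k$-bilinear, cocontinuous in each variable, and compact (the unit is compact and the tensor product of compact objects is compact); a (right) module category in $\mathbf{Pr}$ over it is a compactly generated presentable $\mathbf k$-linear category with a right action that is $\mathbf k$-bilinear, cocontinuous in each variable, and compact. Let $\mathcal A,\mathcal B$ be tensor categories in $\mathbf{Pr}$, with $\mathcal A$ rigid (every compact object has a left and a right dual), and let $F:\mathcal A\to\mathcal B$ be a $\mathbf k$-linear, cocontinuous, compact-object-preserving monoidal functor. For a right $\mathcal B$-module category $\mathcal M$ (action written $N\cdot b$) and $M\in\mathcal M$, let $\mathrm{act}^{\mathcal B}_M:\mathcal B\to\mathcal M$, $b\mapsto M\cdot b$, and $\mathrm{act}^{\mathcal A}_M:\mathcal A\to\mathcal M$, $a\mapsto M\cdot F(a)$. Call $M$ a $\mathcal B$- (resp. $\mathcal A$-) progenerator if $\mathrm{act}^{\mathcal B}_M$ (resp. $\mathrm{act}^{\mathcal A}_M$)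 has a conservative and cocontinuous right adjoint. The values at $N$ of the right adjoints are the internal homs $\underline{\mathrm{Hom}}_{\mathcal B}(M,N)\in\mathcal B$ and $\underline{\mathrm{Hom}}_{\mathcal A}(M,N)\in\mathcal A$; for $N=M$ they are algebras $\underline{\mathrm{End}}_{\mathcal B}(M)$, $\underline{\mathrm{End}}_{\mathcal A}(M)$, and in general they are left modules over these algebras. Applied to $\mathcal B$ acting on itself, this gives $F^R=\underline{\mathrm{Hom}}_{\mathcal A}(1_{\mathcal B},-):\mathcal B\to\mathcal A$, a right adjoint of $F$, and the algebra $E=\underline{\mathrm{End}}_{\mathcal A}(1_{\mathcal B})=F^R(1_{\mathcal B})$, which acts on the left on every $F^R(b)$. Assume that $1_{\mathcal B}$ is an $\mathcal A$-progenerator of $\mathcal B$. Let $\mathcal M$ be a right $\mathcal B$-module category in $\mathbf{Pr}$ and let $M\in\mathcal M$ be an $\mathcal A$-progenerator. The canonical morphism $\rho:E\to\underline{\mathrm{End}}_{\mathcal A}(M)$, corresponding to $M\cdot F(E)\to M\cdot 1_{\mathcal B}\cong M$, is a homomorphism of algebras, and the canonical morphisms $a\otimes E\to F^R(F(a))\leftarrow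 E\otimes a$ are isomorphisms for all $a\in\mathcal A$; through the resulting isomorphisms $a\otimes E\cong E\otimes a$ every left $\underline{\mathrm{End}}_{\mathcal A}(M)$-module $X$ in $\mathcal A$, restricted to a left $E$-module along $\rho$, gets a map $X\otimes E\to X$, used as right action in the relative tensor product $X\otimes_E F^R(b):=\mathrm{coeq}\big(X\otimes E\otimes F^R(b)\rightrightarrows X\otimes F^R(b)\big)$. Then: 1. For all $N\in\mathcal M$ and $b\in\mathcal B$, the canonical morphism $\underline{\mathrm{Hom}}_{\mathcal A}(M,N)\otimes F^R(b)\to\underline{\mathrm{Hom}}_{\mathcal A}(M,N\cdot b)$ exhibits its target as $\underline{\mathrm{Hom}}_{\mathcal A}(M,N)\otimes_E F^R(b)$. Moreover there is a right action of $\mathcal B$ on the category $\underline{\mathrm{End}}_{\mathcal A}(M)\text{-mod}_{\mathcal A}$ of left modules in $\mathcal A$, given by the relative tensor product $X\cdot b=X\otimes_E F^R(b)$ (naturally in $X$, $b$, and with $\underline{\mathrm{End}}_{\mathcal A}(M)$ acting through $X$), for which $\underline{\mathrm{Hom}}_{\mathcal A}(M,-):\mathcal M\to\underline{\mathrm{End}}_{\mathcal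 A}(M)\text{-mod}_{\mathcal A}$, with the above canonical morphisms as structure maps, is a $\mathbf k$-linear equivalence of $\mathcal B$-module categories. 2. $M$ is a $\mathcal B$-progenerator. 3. $\underline{\mathrm{Hom}}_{\mathcal B}(M,-):\mathcal M\to\underline{\mathrm{End}}_{\mathcal B}(M)\text{-mod}_{\mathcal B}$ is a $\mathbf k$-linear equivalence of $\mathcal B$-module categories, where $b$ acts on the target by $X\mapsto X\otimes b$, and the functor $\underline{\mathrm{End}}_{\mathcal B}(M)\text{-mod}_{\mathcal B}\to\underline{\mathrm{End}}_{\mathcal A}(M)\text{-mod}_{\mathcal A}$ induced by $\rho$ is a $\mathbf k$-linear equivalence of $\mathcal B$-module categories for the action in (1). Here the induced functor sends $X$ to $F^R(X)$, on which $\underline{\mathrm{End}}_{\mathcal A}(M)$ acts through $F(\underline{\mathrm{End}}_{\mathcal A}(M))\otimes F(F^R(X))\to\underline{\mathrm{End}}_{\mathcal B}(M)\otimes X\to X$; the restriction of this action along $\rho$ is the canonical $E$-module structure of $F^R(X)$, the $\mathcal B$-module structure of the functor is induced by the canonical maps $F^R(X)\otimes F^R(b)\to F^R(X\otimes b)$,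 and its composite with $\underline{\mathrm{Hom}}_{\mathcal B}(M,-)$ is canonically isomorphic to $\underline{\mathrm{Hom}}_{\mathcal A}(M,-)$. -/

import Mathlib

open CategoryTheory MonoidalCategory Limits Functor
open scoped MonoidalRightAction MonObj

universe v u₁ u₂ u₃ w

/-! ### Presentable linear categories -/

/-- A functor preserving compact (that is, finitely presentable) objects. -/
def PreservesCompact {C : Type u₁} [Category.{v} C] {D : Type u₂} [Category.{v} D]
    (G : C ⥤ D) : Prop :=
  ∀ X : C, IsFinitelyPresentable.{v} X → IsFinitelyPresentable.{v} (G.obj X)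

/-- A tensor category in `Pr`: a compactly generated presentable category with a monoidal structure
whose tensor product is cocontinuous in each variable and compact (compact objects are closed under
tensor products and the unit is compact). The `k`-linear structure and the `k`-bilinearity of the
tensor product are expressed by Mathlib's classes `Linear k C`, `MonoidalPreadditive C` and
`MonoidalLinear k C`. -/
structure IsTensorPr (C : Type u₁) [Category.{v} C] [MonoidalCategory C] : Prop where
  presentable : IsLocallyFinitelyPresentable.{v} C
  cocontinuous_left (X : C) : PreservesColimitsOfSize.{v, v} (tensorLeft X)
  cocontinuous_right (X : C) : PreservesColimitsOfSize.{v, v} (tensorRight X)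
  compact_unit : IsFinitelyPresentable.{v} (𝟙_ C)
  compact_tensor (X Y : C) : IsFinitelyPresentable.{v} X → IsFinitelyPresentable.{v} Y →
    IsFinitelyPresentable.{v} (X ⊗ Y)

/-- Rigidity: every compact object has a left dual and a right dual. -/
def IsRigidPr (C : Type u₁) [Category.{v} C] [MonoidalCategory C] : Prop :=
  ∀ X : C, IsFinitelyPresentable.{v} X → Nonempty (HasLeftDual X) ∧ Nonempty (HasRightDual X)

/-- A right module category in `Pr` over the tensor category `B`: a compactly generated presentable
`k`-linear category with an action of `B` which is `k`-bilinear, cocontinuous in each variable and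
compact. -/
structure IsModulePr (k : Type w) [Field k] (B : Type u₂) [Category.{v} B] [Preadditive B]
    [Linear k B] [MonoidalCategory B] (D : Type u₃) [Category.{v} D] [Preadditive D]
    [Linear k D] [MonoidalRightAction B D] : Prop where
  presentable : IsLocallyFinitelyPresentable.{v} D
  add_left {X Y : D} (f g : X ⟶ Y) (b : B) : (f + g) ⊵ᵣ b = f ⊵ᵣ b + g ⊵ᵣ b
  smul_left {X Y : D} (r : k) (f : X ⟶ Y) (b : B) : (r • f) ⊵ᵣ b = r • (f ⊵ᵣ b)
  add_right (X : D) {b c : B} (f g : b ⟶ c) : X ⊴ᵣ (f + g) = X ⊴ᵣ f + X ⊴ᵣ g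
  smul_right (X : D) {b c : B} (r : k) (f : b ⟶ c) : X ⊴ᵣ (r • f) = r • (X ⊴ᵣ f)
  cocontinuous_left (X : D) :
    PreservesColimitsOfSize.{v, v} (MonoidalRightAction.actionLeft (C := B) X)
  cocontinuous_right (b : B) :
    PreservesColimitsOfSize.{v, v} (MonoidalRightAction.actionRight D b)
  compact_action (X : D) (b : B) : IsFinitelyPresentable.{v} X → IsFinitelyPresentable.{v} b →
    IsFinitelyPresentable.{v} (X ⊙ᵣ b)

/-- A tensor functor in `Pr` (the monoidal structure is carried separately): `k`-linear,
cocontinuous and compact. -/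
structure IsTensorFunctorPr (k : Type w) [Field k] {C : Type u₁} [Category.{v} C] [Preadditive C]
    [Linear k C] {B : Type u₂} [Category.{v} B] [Preadditive B] [Linear k B] (F : C ⥤ B) :
    Prop where
  additive : F.Additive
  linear : F.Linear k
  cocontinuous : PreservesColimitsOfSize.{v, v} F
  compact : PreservesCompact F

/-- `k`-linear equivalences of categories. -/
structure IsLinearEquivalence (k : Type w) [Field k] {C : Type u₁} [Category.{v} C] [Preadditive C]
    [Linear k C] {D : Type u₂} [Category.{v} D] [Preadditive D] [Linear k D] (G : C ⥤ D) :
    Prop where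
  isEquivalence : G.IsEquivalence
  additive : G.Additive
  linear : G.Linear k

/-! ### Internal homs and progenerators

Let `F : C ⥤ B` be a monoidal functor and let `B` act on `D` from the right. Then `C` acts on `D`
through `F`, by `d ◁ c = d ⊙ᵣ F.obj c`. All notions below are those for this action of `C`; for
`F = 𝟭 B` they are the notions for the given action of `B`. -/

section Act

variable {C : Type u₁} [Category.{v} C] {B : Type u₂} [Category.{v} B] [MonoidalCategory B]
  {D : Type u₃} [Category.{v} D] [MonoidalRightAction B D]

/-- The functor `act_m : C ⥤ D`, `c ↦ m ◁ c`. -/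
@[simps]
def act (F : C ⥤ B) (m : D) : C ⥤ D where
  obj c := m ⊙ᵣ F.obj c
  map f := m ⊴ᵣ F.map f

/-- `m` is a progenerator for the action of `C` on `D`: the functor `act_m` has a right adjoint
which is conservative and cocontinuous. -/
def IsProgenerator (F : C ⥤ B) (m : D) : Prop :=
  ∃ (R : D ⥤ C) (_ : act F m ⊣ R), R.ReflectsIsomorphisms ∧ PreservesColimitsOfSize.{v, v} R

end Act

section InducedAction

variable {C : Type u₁} [Category.{v} C] [MonoidalCategory C]
  {B : Type u₂} [Category.{v} B] [MonoidalCategory B]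
  {D : Type u₃} [Category.{v} D] [MonoidalRightAction B D]
  (F : C ⥤ B) [F.Monoidal]

/-- The associativity isomorphism `d ◁ (c ⊗ c') ⟶ (d ◁ c) ◁ c'`. -/
def actAssoc (d : D) (c c' : C) :
    d ⊙ᵣ F.obj (c ⊗ c') ⟶ (d ⊙ᵣ F.obj c) ⊙ᵣ F.obj c' :=
  d ⊴ᵣ OplaxMonoidal.δ F c c' ≫ (αᵣ d (F.obj c) (F.obj c')).hom

/-- The unit isomorphism `d ◁ 𝟙_ C ⟶ d`. -/
def actUnit (d : D) : d ⊙ᵣ F.obj (𝟙_ C) ⟶ d :=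
  d ⊴ᵣ OplaxMonoidal.η F ≫ (ρᵣ d).hom

lemma actAssoc_naturality {d : D} {c₁ c₂ c₁' c₂' : C} (f : c₁ ⟶ c₂) (g : c₁' ⟶ c₂') :
    d ⊴ᵣ F.map (f ⊗ₘ g) ≫ actAssoc F d c₂ c₂' =
      actAssoc F d c₁ c₁' ≫ (d ⊴ᵣ F.map f) ⊵ᵣ F.obj c₁' ≫ (d ⊙ᵣ F.obj c₂) ⊴ᵣ F.map g := by
  have h := MonoidalRightAction.actionAssocIso_hom_naturality (𝟙 d) (F.map f) (F.map g)
  simp only [MonoidalRightAction.id_actionHom] at h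
  rw [MonoidalRightAction.actionHom_def] at h
  simp only [actAssoc, ← MonoidalRightAction.actionHomRight_comp_assoc, Category.assoc, ← h,
    OplaxMonoidal.δ_natural]

lemma actAssoc_naturality_obj {d d' : D} (f : d ⟶ d') (c c' : C) :
    f ⊵ᵣ F.obj (c ⊗ c') ≫ actAssoc F d' c c' =
      actAssoc F d c c' ≫ (f ⊵ᵣ F.obj c) ⊵ᵣ F.obj c' := by
  simp only [actAssoc, ← MonoidalRightAction.action_exchange_assoc, Category.assoc,
    MonoidalRightAction.actionHomLeft_tensor, Iso.inv_hom_id, Category.comp_id]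

lemma actAssoc_assoc (d : D) (c c' c'' : C) :
    d ⊴ᵣ F.map (α_ c c' c'').hom ≫ actAssoc F d c (c' ⊗ c'') ≫
        actAssoc F (d ⊙ᵣ F.obj c) c' c'' =
      actAssoc F d (c ⊗ c') c'' ≫ actAssoc F d c c' ⊵ᵣ F.obj c'' := by
  have h := OplaxMonoidal.associativity F c c' c''
  have h2 := MonoidalRightAction.actionHom_associator (F.obj c) (F.obj c') (F.obj c'') d
  have h3 : (d ⊙ᵣ F.obj c) ⊴ᵣ OplaxMonoidal.δ F c' c'' =
    (αᵣ d (F.obj c) (F.obj (c' ⊗ c''))).inv ≫ d ⊴ᵣ (F.obj c ◁ OplaxMonoidal.δ F c' c'') ≫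
      (αᵣ d (F.obj c) (F.obj c' ⊗ F.obj c'')).hom := by
    simp
  have h4 : (d ⊴ᵣ OplaxMonoidal.δ F c c') ⊵ᵣ F.obj c'' =
    (αᵣ d (F.obj (c ⊗ c')) (F.obj c'')).inv ≫ d ⊴ᵣ (OplaxMonoidal.δ F c c' ▷ F.obj c'') ≫
      (αᵣ d (F.obj c ⊗ F.obj c') (F.obj c'')).hom := by
    simp
  simp only [actAssoc, MonoidalRightAction.comp_actionHomLeft, h3, h4, Category.assoc,
    Iso.hom_inv_id_assoc]
  rw [← h2]
  simp only [← MonoidalRightAction.actionHomRight_comp_assoc, ← h]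

lemma actAssoc_leftUnit (d : D) (c : C) :
    actAssoc F d (𝟙_ C) c ≫ actUnit F d ⊵ᵣ F.obj c = d ⊴ᵣ F.map (λ_ c).hom := by
  have h := OplaxMonoidal.left_unitality_hom F c
  have h2 := MonoidalRightAction.actionHom_leftUnitor (F.obj c) d
  have h4 : (d ⊴ᵣ OplaxMonoidal.η F) ⊵ᵣ F.obj c =
    (αᵣ d (F.obj (𝟙_ C)) (F.obj c)).inv ≫ d ⊴ᵣ (OplaxMonoidal.η F ▷ F.obj c) ≫
      (αᵣ d (𝟙_ B) (F.obj c)).hom := by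
    simp
  simp only [actAssoc, actUnit, MonoidalRightAction.comp_actionHomLeft, h4, Category.assoc,
    Iso.hom_inv_id_assoc]
  rw [← h2]
  simp only [← MonoidalRightAction.actionHomRight_comp, h]

lemma actAssoc_rightUnit (d : D) (c : C) :
    actAssoc F d c (𝟙_ C) ≫ actUnit F (d ⊙ᵣ F.obj c) = d ⊴ᵣ F.map (ρ_ c).hom := by
  have h := OplaxMonoidal.right_unitality_hom F c
  have h2 := MonoidalRightAction.actionHom_rightUnitor (F.obj c) d
  have h3 : (d ⊙ᵣ F.obj c) ⊴ᵣ OplaxMonoidal.η F =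
    (αᵣ d (F.obj c) (F.obj (𝟙_ C))).inv ≫ d ⊴ᵣ (F.obj c ◁ OplaxMonoidal.η F) ≫
      (αᵣ d (F.obj c) (𝟙_ B)).hom := by
    simp
  simp only [actAssoc, actUnit, h3, Category.assoc, Iso.hom_inv_id_assoc]
  rw [← h2]
  simp only [← MonoidalRightAction.actionHomRight_comp, h]

end InducedAction

section HomAdjunction

variable {C : Type u₁} [Category.{v} C] {B : Type u₂} [Category.{v} B] [MonoidalCategory B]
  {D : Type u₃} [Category.{v} D] [MonoidalRightAction B D]
  {F : C ⥤ B} {m : D} {R : D ⥤ C} (adj : act F m ⊣ R)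

/-- For a right adjoint `R` of `act_m`, the object `R.obj N` is the internal hom from `m` to `N`;
this is the evaluation `m ◁ Hom(m, N) ⟶ N`. -/
def evHom (N : D) : m ⊙ᵣ F.obj (R.obj N) ⟶ N := adj.counit.app N

/-- The morphism `c ⟶ Hom(m, N)` corresponding to a morphism `m ◁ c ⟶ N`. -/
def curryHom {c : C} {N : D} (f : m ⊙ᵣ F.obj c ⟶ N) : c ⟶ R.obj N := adj.homEquiv c N f

lemma curryHom_spec {c : C} {N : D} (f : m ⊙ᵣ F.obj c ⟶ N) :
    m ⊴ᵣ F.map (curryHom adj f) ≫ evHom adj N = f :=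
  ((adj.homEquiv_counit (g := adj.homEquiv c N f)).symm.trans
    ((adj.homEquiv c N).symm_apply_apply f) :)

lemma internalHom_ext {c : C} {N : D} {f g : c ⟶ R.obj N}
    (h : m ⊴ᵣ F.map f ≫ evHom adj N = m ⊴ᵣ F.map g ≫ evHom adj N) : f = g := by
  apply (adj.homEquiv c N).symm.injective
  rw [adj.homEquiv_counit, adj.homEquiv_counit]
  exact h

lemma evHom_naturality {N N' : D} (f : N ⟶ N') :
    m ⊴ᵣ F.map (R.map f) ≫ evHom adj N' = evHom adj N ≫ f :=
  adj.counit.naturality f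

end HomAdjunction

section InternalEnd

variable {C : Type u₁} [Category.{v} C] [MonoidalCategory C]
  {B : Type u₂} [Category.{v} B] [MonoidalCategory B]
  {D : Type u₃} [Category.{v} D] [MonoidalRightAction B D]
  {F : C ⥤ B} [F.Monoidal] {m : D} {R : D ⥤ C} (adj : act F m ⊣ R)

/-- The composition `End(m) ⊗ Hom(m, N) ⟶ Hom(m, N)`. -/
def internalComp (N : D) : R.obj m ⊗ R.obj N ⟶ R.obj N :=
  curryHom adj (actAssoc F m (R.obj m) (R.obj N) ≫ evHom adj m ⊵ᵣ F.obj (R.obj N) ≫ evHom adj N)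

/-- The identity `𝟙_ C ⟶ End(m)`. -/
def internalId : 𝟙_ C ⟶ R.obj m := curryHom adj (actUnit F m)

lemma internalId_comp (N : D) :
    internalId adj ▷ R.obj N ≫ internalComp adj N = (λ_ (R.obj N)).hom := by
  apply internalHom_ext adj
  have h := actAssoc_naturality F (d := m) (internalId adj) (𝟙 (R.obj N))
  simp only [tensorHom_id, F.map_id, MonoidalRightAction.actionHomRight_id, Category.comp_id] at h
  rw [F.map_comp, MonoidalRightAction.actionHomRight_comp, Category.assoc, internalComp,
    curryHom_spec, reassoc_of% h, ← MonoidalRightAction.comp_actionHomLeft_assoc, internalId,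
    curryHom_spec, ← actAssoc_leftUnit, Category.assoc]

lemma internalComp_assoc (N : D) :
    internalComp adj m ▷ R.obj N ≫ internalComp adj N =
      (α_ (R.obj m) (R.obj m) (R.obj N)).hom ≫ R.obj m ◁ internalComp adj N ≫
        internalComp adj N := by
  apply internalHom_ext adj
  have h := actAssoc_naturality F (d := m) (internalComp adj m) (𝟙 (R.obj N))
  have h' := actAssoc_naturality F (d := m) (𝟙 (R.obj m)) (internalComp adj N)
  simp only [tensorHom_id, id_tensorHom, F.map_id, MonoidalRightAction.actionHomRight_id,
    MonoidalRightAction.id_actionHomLeft, Category.comp_id, Category.id_comp] at h h'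
  have e1 : m ⊴ᵣ F.map (internalComp adj N) ≫ evHom adj N = _ := curryHom_spec adj _
  have e2 : m ⊴ᵣ F.map (internalComp adj m) ≫ evHom adj m = _ := curryHom_spec adj _
  simp only [F.map_comp, MonoidalRightAction.actionHomRight_comp, Category.assoc]
  rw [e1, reassoc_of% h, reassoc_of% h', ← MonoidalRightAction.comp_actionHomLeft_assoc, e2,
    MonoidalRightAction.action_exchange_assoc, e1]
  simp only [MonoidalRightAction.comp_actionHomLeft, Category.assoc]
  rw [reassoc_of% (actAssoc_naturality_obj F (evHom adj m)), reassoc_of% (actAssoc_assoc F m)]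

lemma internalComp_id : R.obj m ◁ internalId adj ≫ internalComp adj m = (ρ_ (R.obj m)).hom := by
  apply internalHom_ext adj
  have h' := actAssoc_naturality F (d := m) (𝟙 (R.obj m)) (internalId adj)
  simp only [id_tensorHom, F.map_id, MonoidalRightAction.actionHomRight_id,
    MonoidalRightAction.id_actionHomLeft, Category.id_comp] at h'
  have e2 : m ⊴ᵣ F.map (internalId adj) ≫ evHom adj m = _ := curryHom_spec adj _
  rw [F.map_comp, MonoidalRightAction.actionHomRight_comp, Category.assoc, internalComp,
    curryHom_spec, reassoc_of% h', MonoidalRightAction.action_exchange_assoc, e2,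
    ← actAssoc_rightUnit, Category.assoc]
  simp only [actUnit, Category.assoc, ← MonoidalRightAction.action_exchange_assoc,
    MonoidalRightAction.actionUnitIso_hom_naturality]

/-- The internal endomorphism algebra `End(m)`, an algebra in `C`. -/
@[simps X]
def endAlg : Mon C where
  X := R.obj m
  mon :=
    { one := internalId adj
      mul := internalComp adj m
      one_mul := internalId_comp adj m
      mul_one := internalComp_id adj
      mul_assoc := internalComp_assoc adj m }

/-- The canonical functor `D ⥤ End(m)-mod_C`, `N ↦ Hom(m, N)`. -/
def toMod : D ⥤ Mod C (endAlg adj).X where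
  obj N :=
    { X := R.obj N
      mod :=
        { smul := internalComp adj N
          one_smul := internalId_comp adj N
          mul_smul := internalComp_assoc adj N } }
  map {N N'} f := Mod.Hom.mk' (R.map f) (by
    apply internalHom_ext adj
    have h' := actAssoc_naturality F (d := m) (𝟙 (R.obj m)) (R.map f)
    simp only [id_tensorHom, F.map_id, MonoidalRightAction.actionHomRight_id,
      MonoidalRightAction.id_actionHomLeft, Category.id_comp] at h'
    have e (N : D) : m ⊴ᵣ F.map (internalComp adj N) ≫ evHom adj N = _ := curryHom_spec adj _
    change m ⊴ᵣ F.map (internalComp adj N ≫ R.map f) ≫ evHom adj N' =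
      m ⊴ᵣ F.map (R.obj m ◁ R.map f ≫ internalComp adj N') ≫ evHom adj N'
    simp only [F.map_comp, MonoidalRightAction.actionHomRight_comp, Category.assoc]
    rw [e, evHom_naturality, reassoc_of% (e N), reassoc_of% h',
      MonoidalRightAction.action_exchange_assoc, evHom_naturality])
  map_id N := by ext; exact R.map_id N
  map_comp f g := by ext; exact R.map_comp f g

/-- The canonical morphism `Hom(m, N) ⊗ c ⟶ Hom(m, N ◁ c)`. -/
def tensorHomMap (N : D) (c : C) : R.obj N ⊗ c ⟶ R.obj (N ⊙ᵣ F.obj c) :=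
  curryHom adj (actAssoc F m (R.obj N) c ≫ evHom adj N ⊵ᵣ F.obj c)

end InternalEnd

/-! ### Modules over an algebra -/

section ModStructures

variable {C : Type u₁} [Category.{v} C] [MonoidalCategory C] (S : C) [MonObj S]

/-- The right action of `C` on the category of left `S`-modules in `C`: the module `X ⊙ᵣ c` is
`X ⊗ c`, on which `S` acts through `X`. -/
instance modRightAction : MonoidalRightAction C (Mod C S) where
  actionObj X c :=
    { X := X.X ⊗ c
      mod :=
        { smul := (α_ S X.X c).inv ≫ γ[S, X.X] ▷ c
          one_smul := by
            have h := ModObj.one_smul_self S X.X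
            change η ▷ (X.X ⊗ c) ≫ (α_ S X.X c).inv ≫ γ[S, X.X] ▷ c = (λ_ (X.X ⊗ c)).hom
            rw [associator_inv_naturality_left_assoc, ← comp_whiskerRight, h]
            simp
          mul_smul := by
            have h := ModObj.mul_smul_self S X.X
            change μ ▷ (X.X ⊗ c) ≫ (α_ S X.X c).inv ≫ γ[S, X.X] ▷ c =
              (α_ S S (X.X ⊗ c)).hom ≫ S ◁ ((α_ S X.X c).inv ≫ γ[S, X.X] ▷ c) ≫
                (α_ S X.X c).inv ≫ γ[S, X.X] ▷ c
            rw [associator_inv_naturality_left_assoc, ← comp_whiskerRight, h]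
            simp } }
  actionHomLeft {X Y} f c := Mod.Hom.mk' (f.hom ▷ c) (by
    have h : γ[S, X.X] ≫ f.hom = S ◁ f.hom ≫ γ[S, Y.X] := IsModHom.smul_hom
    change ((α_ S X.X c).inv ≫ γ[S, X.X] ▷ c) ≫ f.hom ▷ c =
      S ◁ (f.hom ▷ c) ≫ (α_ S Y.X c).inv ≫ γ[S, Y.X] ▷ c
    rw [Category.assoc, ← comp_whiskerRight, h]
    simp)
  actionHomRight X c c' f := Mod.Hom.mk' (X.X ◁ f) (by
    change ((α_ S X.X c).inv ≫ γ[S, X.X] ▷ c) ≫ X.X ◁ f =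
      S ◁ (X.X ◁ f) ≫ (α_ S X.X c').inv ≫ γ[S, X.X] ▷ c'
    rw [Category.assoc, ← whisker_exchange]
    simp)
  actionAssocIso X c c' :=
    { hom := Mod.Hom.mk' (α_ X.X c c').inv (by
        change ((α_ S X.X (c ⊗ c')).inv ≫ γ[S, X.X] ▷ (c ⊗ c')) ≫ (α_ X.X c c').inv =
          S ◁ (α_ X.X c c').inv ≫ (α_ S (X.X ⊗ c) c').inv ≫
            ((α_ S X.X c).inv ≫ γ[S, X.X] ▷ c) ▷ c'
        simp)
      inv := Mod.Hom.mk' (α_ X.X c c').hom (by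
        change ((α_ S (X.X ⊗ c) c').inv ≫ ((α_ S X.X c).inv ≫ γ[S, X.X] ▷ c) ▷ c') ≫
          (α_ X.X c c').hom = S ◁ (α_ X.X c c').hom ≫ (α_ S X.X (c ⊗ c')).inv ≫
            γ[S, X.X] ▷ (c ⊗ c')
        simp)
      hom_inv_id := by ext; exact (α_ X.X c c').inv_hom_id
      inv_hom_id := by ext; exact (α_ X.X c c').hom_inv_id }
  actionUnitIso X :=
    { hom := Mod.Hom.mk' (ρ_ X.X).hom (by
        change ((α_ S X.X (𝟙_ C)).inv ≫ γ[S, X.X] ▷ (𝟙_ C)) ≫ (ρ_ X.X).hom =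
          S ◁ (ρ_ X.X).hom ≫ γ[S, X.X]
        simp)
      inv := Mod.Hom.mk' (ρ_ X.X).inv (by
        change γ[S, X.X] ≫ (ρ_ X.X).inv =
          S ◁ (ρ_ X.X).inv ≫ (α_ S X.X (𝟙_ C)).inv ≫ γ[S, X.X] ▷ (𝟙_ C)
        simp)
      hom_inv_id := by ext; exact (ρ_ X.X).hom_inv_id
      inv_hom_id := by ext; exact (ρ_ X.X).inv_hom_id }
  actionHomRight_id c X := by ext; exact whiskerLeft_id X.X c
  id_actionHomLeft c X := by ext; exact id_whiskerRight X.X c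
  actionHom_comp f₁ f₂ g₁ g₂ := by
    ext
    change (f₁.hom ≫ f₂.hom) ▷ _ ≫ _ ◁ (g₁ ≫ g₂) =
      (f₁.hom ▷ _ ≫ _ ◁ g₁) ≫ f₂.hom ▷ _ ≫ _ ◁ g₂
    simp only [comp_whiskerRight, MonoidalCategory.whiskerLeft_comp, Category.assoc,
      whisker_exchange_assoc]
  actionAssocIso_hom_naturality f g h := by
    ext
    change (f.hom ▷ _ ≫ _ ◁ (g ⊗ₘ h)) ≫ (α_ _ _ _).inv =
      (α_ _ _ _).inv ≫ (f.hom ▷ _ ≫ _ ◁ g) ▷ _ ≫ _ ◁ h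
    simp [MonoidalCategory.tensorHom_def]
  actionUnitIso_hom_naturality f := by
    ext
    change (ρ_ _).hom ≫ f.hom = f.hom ▷ _ ≫ (ρ_ _).hom
    simp
  actionHomRight_whiskerRight f c X := by
    ext
    change X.X ◁ (f ▷ c) = (α_ _ _ _).inv ≫ (X.X ◁ f) ▷ c ≫ (α_ _ _ _).hom
    simp
  whiskerRight_actionHomLeft c _ _ f X := by
    ext
    change X.X ◁ (c ◁ f) = (α_ _ _ _).inv ≫ (X.X ⊗ c) ◁ f ≫ (α_ _ _ _).hom
    simp
  actionHom_associator c₁ c₂ c₃ X := by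
    ext
    change X.X ◁ (α_ c₁ c₂ c₃).hom ≫ (α_ _ _ _).inv ≫ (α_ _ _ _).inv =
      (α_ _ _ _).inv ≫ (α_ _ _ _).inv ▷ c₃
    simp
  actionHom_leftUnitor c X := by
    ext
    change X.X ◁ (λ_ c).hom = (α_ _ _ _).inv ≫ (ρ_ _).hom ▷ c
    simp
  actionHom_rightUnitor c X := by
    ext
    change X.X ◁ (ρ_ c).hom = (α_ _ _ _).inv ≫ (ρ_ _).hom
    simp

variable [Preadditive C] [MonoidalPreadditive C]

/-- Module homomorphisms form a subgroup of the morphisms of underlying objects. -/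
def modHomSubgroup (X Y : Mod C S) : AddSubgroup (X.X ⟶ Y.X) where
  carrier := {f | γ[S, X.X] ≫ f = S ◁ f ≫ γ[S, Y.X]}
  zero_mem' := by simp
  add_mem' {f g} hf hg := by
    simp only [Set.mem_ofPred_eq] at hf hg ⊢
    simp [hf, hg]
  neg_mem' {f} hf := by
    simp only [Set.mem_ofPred_eq] at hf ⊢
    have : S ◁ (-f) = -(S ◁ f) := (tensorLeft S).map_neg
    simp [hf, this]

/-- Module homomorphisms as elements of `modHomSubgroup`. -/
def modHomEquiv (X Y : Mod C S) : (X ⟶ Y) ≃ modHomSubgroup S X Y where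
  toFun f := ⟨f.hom, IsModHom.smul_hom⟩
  invFun f := Mod.Hom.mk' f.1 f.2
  left_inv _ := rfl
  right_inv _ := rfl

instance modPreadditive : Preadditive (Mod C S) where
  homGroup X Y := (modHomEquiv S X Y).addCommGroup
  add_comp X Y Z f f' g := by ext; exact Preadditive.add_comp _ _ _ f.hom f'.hom g.hom
  comp_add X Y Z f g g' := by ext; exact Preadditive.comp_add _ _ _ f.hom g.hom g'.hom

lemma whiskerLeft_smul_of_linear {k : Type w} [Field k] [Linear k C] [MonoidalLinear k C]
    (X Y : Mod C S) (r : k) (f : X ⟶ Y) :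
    γ[S, X.X] ≫ (r • f.hom) = S ◁ (r • f.hom) ≫ γ[S, Y.X] := by
  have h : γ[S, X.X] ≫ f.hom = S ◁ f.hom ≫ γ[S, Y.X] := IsModHom.smul_hom
  simp [h]

instance modLinear {k : Type w} [Field k] [Linear k C] [MonoidalLinear k C] :
    Linear k (Mod C S) where
  homModule X Y :=
    { smul := fun r f => Mod.Hom.mk' (r • f.hom) (whiskerLeft_smul_of_linear S X Y r f)
      one_smul := fun f => by ext; exact one_smul k f.hom
      mul_smul := fun r s f => by ext; exact mul_smul r s f.hom
      smul_zero := fun r => by ext; exact smul_zero r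
      smul_add := fun r f g => by ext; exact smul_add r f.hom g.hom
      add_smul := fun r s f => by ext; exact add_smul r s f.hom
      zero_smul := fun f => by ext; exact zero_smul k f.hom }
  smul_comp X Y Z r f g := by ext; exact Linear.smul_comp _ _ _ r f.hom g.hom
  comp_smul X Y Z f r g := by ext; exact Linear.comp_smul _ _ _ f.hom r g.hom

end ModStructures

/-! ### Change of the acting category

`F : A ⥤ B` is a monoidal functor, `R : B ⥤ A` is right adjoint to the action of `A` on the unit of
`B` (so `R.obj b = Hom_A(𝟙_ B, b)`, and `R` is a right adjoint of `F`, as `𝟙_ B ⊗ F.obj a` is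
`F.obj a`); `B` acts on `M` from the right, `m : M`, and `RA : M ⥤ A` and `RB : M ⥤ B` are the
internal homs out of `m` for the actions of `A` and of `B`. -/

section BaseChangeLaws

variable {A : Type u₁} [Category.{v} A] [MonoidalCategory A]
  {B : Type u₂} [Category.{v} B] [MonoidalCategory B] {F : A ⥤ B} [F.Monoidal]

lemma baseChange_one_aux {P Z : A} {Q X : B} (u : 𝟙_ A ⟶ P) (e : 𝟙_ B ⟶ Q) (t : F.obj P ⟶ Q)
    (c : F.obj Z ⟶ X) (a : P ⊗ Z ⟶ Z) (g : Q ⊗ X ⟶ X)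
    (ht : F.map u ≫ t = OplaxMonoidal.η F ≫ e) (hg : e ▷ X ≫ g = (λ_ X).hom)
    (ha : F.map a ≫ c = OplaxMonoidal.δ F P Z ≫ (t ⊗ₘ c) ≫ g) :
    F.map (u ▷ Z ≫ a) ≫ c = F.map (λ_ Z).hom ≫ c := by
  have h2 : F.map u ▷ F.obj Z ≫ (t ⊗ₘ c) =
      OplaxMonoidal.η F ▷ F.obj Z ≫ 𝟙_ B ◁ c ≫ e ▷ X := by
    rw [MonoidalCategory.tensorHom_def, ← comp_whiskerRight_assoc, ht, comp_whiskerRight,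
      Category.assoc, whisker_exchange]
  rw [F.map_comp, Category.assoc, ha, ← OplaxMonoidal.δ_natural_left_assoc, reassoc_of% h2, hg,
    leftUnitor_naturality, OplaxMonoidal.left_unitality_hom_assoc]

lemma baseChange_mul_aux {P Z : A} {Q X : B} (p : P ⊗ P ⟶ P) (q : Q ⊗ Q ⟶ Q) (t : F.obj P ⟶ Q)
    (c : F.obj Z ⟶ X) (a : P ⊗ Z ⟶ Z) (g : Q ⊗ X ⟶ X)
    (ht : F.map p ≫ t = OplaxMonoidal.δ F P P ≫ (t ⊗ₘ t) ≫ q)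
    (hg : q ▷ X ≫ g = (α_ Q Q X).hom ≫ Q ◁ g ≫ g)
    (ha : F.map a ≫ c = OplaxMonoidal.δ F P Z ≫ (t ⊗ₘ c) ≫ g) :
    F.map (p ▷ Z ≫ a) ≫ c = F.map ((α_ P P Z).hom ≫ P ◁ a ≫ a) ≫ c := by
  have h2 : F.map p ▷ F.obj Z ≫ (t ⊗ₘ c) =
      OplaxMonoidal.δ F P P ▷ F.obj Z ≫ ((t ⊗ₘ t) ⊗ₘ c) ≫ q ▷ X := by
    rw [MonoidalCategory.tensorHom_def, ← comp_whiskerRight_assoc, ht]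
    rw [comp_whiskerRight, comp_whiskerRight, Category.assoc, Category.assoc, ← whisker_exchange,
      MonoidalCategory.tensorHom_def (t ⊗ₘ t) c, Category.assoc]
  have h3 : F.obj P ◁ F.map a ≫ (t ⊗ₘ c) =
      F.obj P ◁ OplaxMonoidal.δ F P Z ≫ (t ⊗ₘ (t ⊗ₘ c)) ≫ Q ◁ g := by
    rw [MonoidalCategory.tensorHom_def', ← MonoidalCategory.whiskerLeft_comp_assoc, ha]
    rw [MonoidalCategory.whiskerLeft_comp, MonoidalCategory.whiskerLeft_comp, Category.assoc,
      Category.assoc, whisker_exchange, ← MonoidalCategory.tensorHom_def' t c,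
      MonoidalCategory.tensorHom_def' t (t ⊗ₘ c), Category.assoc]
  simp only [F.map_comp, Category.assoc]
  rw [ha, ← OplaxMonoidal.δ_natural_left_assoc, reassoc_of% h2, hg,
    ← OplaxMonoidal.δ_natural_right_assoc, reassoc_of% h3, associator_naturality_assoc,
    OplaxMonoidal.associativity_assoc]

lemma baseChange_map_aux {P Z Z' : A} {Q X X' : B} (t : F.obj P ⟶ Q)
    (c : F.obj Z ⟶ X) (c' : F.obj Z' ⟶ X') (a : P ⊗ Z ⟶ Z) (a' : P ⊗ Z' ⟶ Z')
    (g : Q ⊗ X ⟶ X) (g' : Q ⊗ X' ⟶ X') (f : X ⟶ X') (r : Z ⟶ Z')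
    (hf : g ≫ f = Q ◁ f ≫ g') (hr : F.map r ≫ c' = c ≫ f)
    (ha : F.map a ≫ c = OplaxMonoidal.δ F P Z ≫ (t ⊗ₘ c) ≫ g)
    (ha' : F.map a' ≫ c' = OplaxMonoidal.δ F P Z' ≫ (t ⊗ₘ c') ≫ g') :
    F.map (a ≫ r) ≫ c' = F.map (P ◁ r ≫ a') ≫ c' := by
  have h : F.obj P ◁ F.map r ≫ (t ⊗ₘ c') = (t ⊗ₘ c) ≫ Q ◁ f := by
    rw [MonoidalCategory.tensorHom_def', ← MonoidalCategory.whiskerLeft_comp_assoc, hr,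
      MonoidalCategory.whiskerLeft_comp, Category.assoc, whisker_exchange,
      MonoidalCategory.tensorHom_def', Category.assoc]
  rw [F.map_comp, Category.assoc, hr, reassoc_of% ha, hf, F.map_comp, Category.assoc, ha',
    ← OplaxMonoidal.δ_natural_right_assoc, reassoc_of% h]

end BaseChangeLaws

section BaseChange

variable {A : Type u₁} [Category.{v} A] {B : Type u₂} [Category.{v} B] [MonoidalCategory B]
  {M : Type u₃} [Category.{v} M] [MonoidalRightAction B M]
  {F : A ⥤ B} {R : B ⥤ A} (adj : act F (𝟙_ B) ⊣ R)
  {m : M} {RA : M ⥤ A} (adjA : act F m ⊣ RA)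
  {RB : M ⥤ B} (adjB : act (𝟭 B) m ⊣ RB)

/-- The counit `F(R(b)) ⟶ b`. -/
def counitHom (b : B) : F.obj (R.obj b) ⟶ b := (λ_ (F.obj (R.obj b))).inv ≫ evHom adj b

/-- The canonical morphism `F(Hom_A(m, N)) ⟶ Hom_B(m, N)`. -/
def compareHom (N : M) : F.obj (RA.obj N) ⟶ RB.obj N :=
  curryHom (F := 𝟭 B) adjB (evHom adjA N)

lemma compareHom_spec (N : M) :
    m ⊴ᵣ compareHom adjA adjB N ≫ evHom adjB N = evHom adjA N :=
  curryHom_spec (F := 𝟭 B) adjB _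

lemma map_curryHom_counit {c : A} {b : B} (g : F.obj c ⟶ b) :
    F.map (curryHom adj ((λ_ _).hom ≫ g)) ≫ counitHom adj b = g := by
  have h := curryHom_spec adj ((λ_ (F.obj c)).hom ≫ g)
  change 𝟙_ B ◁ F.map _ ≫ _ = _ at h
  rw [counitHom, leftUnitor_inv_naturality_assoc, h, Iso.inv_hom_id_assoc]

lemma homToRight_ext {c : A} {b : B} {f g : c ⟶ R.obj b}
    (h : F.map f ≫ counitHom adj b = F.map g ≫ counitHom adj b) : f = g := by
  apply internalHom_ext adj
  change 𝟙_ B ◁ F.map f ≫ _ = 𝟙_ B ◁ F.map g ≫ _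
  rw [counitHom, leftUnitor_inv_naturality_assoc, leftUnitor_inv_naturality_assoc] at h
  exact (cancel_epi _).1 h

lemma counitHom_naturality {b b' : B} (f : b ⟶ b') :
    F.map (R.map f) ≫ counitHom adj b' = counitHom adj b ≫ f := by
  have h := evHom_naturality adj f
  change 𝟙_ B ◁ F.map (R.map f) ≫ _ = _ at h
  rw [counitHom, leftUnitor_inv_naturality_assoc, h, counitHom, Category.assoc]

variable [MonoidalCategory A] [F.Monoidal]

/-- The canonical morphism `ρ : End_A(𝟙_ B) ⟶ End_A(m)`, corresponding to
`m ◁ End_A(𝟙_ B) ⟶ m ⊙ᵣ 𝟙_ B ≅ m`. -/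
def rhoHom : (endAlg adj).X ⟶ (endAlg adjA).X :=
  curryHom adjA (m ⊴ᵣ counitHom adj (𝟙_ B) ≫ (ρᵣ m).hom)

/-- The canonical morphism `End_A(𝟙_ B) ⊗ a ⟶ R(F(a))`, corresponding to
`F(End_A(𝟙_ B)) ⊗ F(a) ⟶ 𝟙_ B ⊗ F(a) ≅ F(a)`. -/
def freeLeft (a : A) : (endAlg adj).X ⊗ a ⟶ R.obj (F.obj a) :=
  curryHom adj ((λ_ _).hom ≫ OplaxMonoidal.δ F _ a ≫ counitHom adj (𝟙_ B) ▷ F.obj a ≫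
    (λ_ (F.obj a)).hom)

/-- The canonical morphism `a ⊗ End_A(𝟙_ B) ⟶ R(F(a))`, corresponding to
`F(a) ⊗ F(End_A(𝟙_ B)) ⟶ F(a) ⊗ 𝟙_ B ≅ F(a)`. -/
def freeRight (a : A) : a ⊗ (endAlg adj).X ⟶ R.obj (F.obj a) :=
  curryHom adj ((λ_ _).hom ≫ OplaxMonoidal.δ F a _ ≫ F.obj a ◁ counitHom adj (𝟙_ B) ≫
    (ρ_ (F.obj a)).hom)

/-- The canonical morphism `Hom_A(m, N) ⊗ R(b) ⟶ Hom_A(m, N ⊙ᵣ b)`, corresponding to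
`(m ◁ Hom_A(m, N)) ◁ R(b) ⟶ N ⊙ᵣ F(R(b)) ⟶ N ⊙ᵣ b`. -/
def relMap (N : M) (b : B) : RA.obj N ⊗ R.obj b ⟶ RA.obj (N ⊙ᵣ b) :=
  curryHom adjA (actAssoc F m (RA.obj N) (R.obj b) ≫ evHom adjA N ⊵ᵣ F.obj (R.obj b) ≫
    N ⊴ᵣ counitHom adj b)

/-- The left `End_A(𝟙_ B)`-action on an `End_A(m)`-module obtained by restriction along `ρ`. -/
def restrictedAction (X : Mod A (endAlg adjA).X) : (endAlg adj).X ⊗ X.X ⟶ X.X :=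
  rhoHom adj adjA ▷ X.X ≫ γ[(endAlg adjA).X, X.X]

lemma compareHom_one :
    F.map (internalId adjA) ≫ compareHom adjA adjB m =
      OplaxMonoidal.η F ≫ internalId adjB := by
  apply internalHom_ext adjB
  have e1 : m ⊴ᵣ F.map (internalId adjA) ≫ evHom adjA m = _ := curryHom_spec adjA _
  have e2 : m ⊴ᵣ (internalId adjB) ≫ evHom adjB m = _ := curryHom_spec adjB _
  have e3 := compareHom_spec adjA adjB m
  simp only [Functor.id_map, MonoidalRightAction.actionHomRight_comp, Category.assoc]
  erw [e3, e2]
  rw [e1]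
  simp [actUnit]

lemma compareHom_mul (N : M) :
    F.map (internalComp adjA N) ≫ compareHom adjA adjB N =
      OplaxMonoidal.δ F _ _ ≫ (compareHom adjA adjB m ⊗ₘ compareHom adjA adjB N) ≫
        internalComp adjB N := by
  apply internalHom_ext adjB
  have e1 : m ⊴ᵣ F.map (internalComp adjA N) ≫ evHom adjA N = _ := curryHom_spec adjA _
  have e2 : m ⊴ᵣ (internalComp adjB N) ≫ evHom adjB N = _ := curryHom_spec adjB _
  have e3 := compareHom_spec adjA adjB N
  have e4 := compareHom_spec adjA adjB m
  have e5 := actAssoc_naturality (𝟭 B) (d := m) (compareHom adjA adjB m) (compareHom adjA adjB N)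
  simp only [Functor.id_map, Functor.id_obj] at e5
  simp only [Functor.id_map, MonoidalRightAction.actionHomRight_comp, Category.assoc]
  erw [e3, e2]
  rw [e1]
  erw [reassoc_of% e5]
  erw [MonoidalRightAction.action_exchange_assoc, e3, ← MonoidalRightAction.comp_actionHomLeft_assoc, e4]
  simp [actAssoc]

/-- The action map of `End_A(m)` on `R(X)`, for a left `End_B(m)`-module `X` in `B`: it corresponds to
`F(End_A(m)) ⊗ F(R(X)) ⟶ End_B(m) ⊗ X ⟶ X`. -/
def baseChangeSmul (X : Mod B (endAlg adjB).X) : (endAlg adjA).X ⊗ R.obj X.X ⟶ R.obj X.X :=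
  curryHom adj ((λ_ _).hom ≫ OplaxMonoidal.δ F _ _ ≫
    (compareHom adjA adjB m ⊗ₘ counitHom adj X.X) ≫ γ[(endAlg adjB).X, X.X])

lemma baseChangeSmul_spec (X : Mod B (endAlg adjB).X) :
    F.map (baseChangeSmul adj adjA adjB X) ≫ counitHom adj X.X =
      OplaxMonoidal.δ F _ _ ≫ (compareHom adjA adjB m ⊗ₘ counitHom adj X.X) ≫
        γ[(endAlg adjB).X, X.X] :=
  map_curryHom_counit adj _

lemma baseChangeSmul_one (X : Mod B (endAlg adjB).X) :
    internalId adjA ▷ R.obj X.X ≫ baseChangeSmul adj adjA adjB X = (λ_ (R.obj X.X)).hom := by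
  apply homToRight_ext adj
  exact baseChange_one_aux (internalId adjA) (internalId adjB) (compareHom adjA adjB m)
    (counitHom adj X.X) _ γ[(endAlg adjB).X, X.X] (compareHom_one adjA adjB)
    (ModObj.one_smul_self (endAlg adjB).X X.X) (baseChangeSmul_spec adj adjA adjB X)

lemma baseChangeSmul_mul (X : Mod B (endAlg adjB).X) :
    internalComp adjA m ▷ R.obj X.X ≫ baseChangeSmul adj adjA adjB X =
      (α_ (RA.obj m) (RA.obj m) (R.obj X.X)).hom ≫
        RA.obj m ◁ baseChangeSmul adj adjA adjB X ≫ baseChangeSmul adj adjA adjB X := by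
  apply homToRight_ext adj
  exact baseChange_mul_aux (internalComp adjA m) (internalComp adjB m) (compareHom adjA adjB m)
    (counitHom adj X.X) _ γ[(endAlg adjB).X, X.X] (compareHom_mul adjA adjB m)
    (ModObj.mul_smul_self (endAlg adjB).X X.X) (baseChangeSmul_spec adj adjA adjB X)

/-- The left `End_A(m)`-module structure on `R(X)`, for a left `End_B(m)`-module `X` in `B`: the
action corresponds to `F(End_A(m)) ⊗ F(R(X)) ⟶ End_B(m) ⊗ X ⟶ X`. -/
def baseChangeObj (X : Mod B (endAlg adjB).X) : Mod A (endAlg adjA).X where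
  X := R.obj X.X
  mod :=
    { smul := baseChangeSmul adj adjA adjB X
      one_smul := baseChangeSmul_one adj adjA adjB X
      mul_smul := baseChangeSmul_mul adj adjA adjB X }

/-- The functor `End_B(m)-mod_B ⥤ End_A(m)-mod_A` lying over `R : B ⥤ A`. -/
def baseChange : Mod B (endAlg adjB).X ⥤ Mod A (endAlg adjA).X where
  obj X := baseChangeObj adj adjA adjB X
  map {X Y} f := Mod.Hom.mk' (R.map f.hom) (by
    apply homToRight_ext adj
    exact baseChange_map_aux (compareHom adjA adjB m) (counitHom adj X.X) (counitHom adj Y.X) _ _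
      γ[(endAlg adjB).X, X.X] γ[(endAlg adjB).X, Y.X] f.hom (R.map f.hom) IsModHom.smul_hom
      (counitHom_naturality adj f.hom) (baseChangeSmul_spec adj adjA adjB X)
      (baseChangeSmul_spec adj adjA adjB Y))
  map_id X := by ext; exact R.map_id X.X
  map_comp f g := by ext; exact R.map_comp f.hom g.hom

end BaseChange

/-- `q : X ⊗ Y ⟶ Z` exhibits `Z` as the relative tensor product `X ⊗_S Y`, for a right action
`t : X ⊗ S ⟶ X` and a left action `s : S ⊗ Y ⟶ Y`: it is a coequalizer of the two maps
`(X ⊗ S) ⊗ Y ⇉ X ⊗ Y`. -/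
def IsRelativeTensor {C : Type u₁} [Category.{v} C] [MonoidalCategory C] {S X Y Z : C}
    (t : X ⊗ S ⟶ X) (s : S ⊗ Y ⟶ Y) (q : X ⊗ Y ⟶ Z) : Prop :=
  ∃ h : t ▷ Y ≫ q = ((α_ X S Y).hom ≫ X ◁ s) ≫ q, Nonempty (IsColimit (Cofork.ofπ q h))

/-!
Write `E = End_A(𝟙)`, `P = End_A(m)`, and `R` and `Hom_A(m, -)` for the right adjoints of `F` and of
`a ↦ m ⊙ᵣ F(a)`.

*Projection formula.* The morphism `Hom_A(m, N) ⊗ a ⟶ Hom_A(m, N ⊙ᵣ F(a))` is invertible for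
dualizable `a` by adjunction. Both sides are cocontinuous in `a`, and every object of `A` is a colimit
of compact, hence dualizable, ones, so it is invertible for all `a`
(`isIso_tensorHomMap_of_isRigidPr`). The case `m = N = 𝟙` and its mirror image say that
`E ⊗ a ≅ R(F(a)) ≅ a ⊗ E`.

*Monadicity.* A conservative right adjoint which preserves coequalizers presents each object as a
coequalizer of objects in the image of the left adjoint (`isCoequalizer_counit`). Together with the
projection formula this makes `Hom_A(m, -)` an equivalence from `M` to `P`-modules
(`toMod_isEquivalence`); in particular `B` is the category of `E`-modules in `A`.

*Relative tensor products.* Applying the cocontinuous functor `Hom_A(m, N ⊙ᵣ -)` to the presentation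
of `b` by objects `F(a)`, and rewriting the terms by the projection formula, exhibits
`Hom_A(m, N ⊙ᵣ b)` as `Hom_A(m, N) ⊗_E R(b)` (`isCoequalizer_relMap`). Hence the action of `B` on
`M`, transported to `P`-modules along the equivalence, is given by relative tensor products over
`E`.

*The action of `B`.* By the same presentation, morphisms `m ⊙ᵣ b ⟶ N` are the same as `E`-linear
morphisms `R(b) ⟶ Hom_A(m, N)` (`toRestrictedHom_bijective`). As `B` is the category of `E`-modules,
this functor of `b` is representable, which gives `Hom_B(m, -)` (`exists_act_adjunction`). Since
`R(Hom_B(m, N)) ≅ Hom_A(m, N)` and `R` is conservative and cocontinuous, `Hom_B(m, -)` inherits both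
properties from `Hom_A(m, -)`, so `m` is a `B`-progenerator. `B` need not be rigid; the projection
formula for `Hom_B(m, -)` holds because `R` sends it to the comparison of two presentations of the
same relative tensor product over `E` (`isIso_tensorHomB`). Monadicity then identifies `M` with
`End_B(m)`-modules, and the functor from `End_B(m)`-modules to `P`-modules is an equivalence by
two out of three; its linear structure is determined by those of `Hom_B(m, -)` and `Hom_A(m, -)`
(`rightLinearOfComp`).
-/

universe u

/-! ### Coequalizers -/

section Coequalizers

variable {C : Type u₁} [Category.{v} C]

/-- `q` is a coequalizer of `f` and `g`. For the two maps `(X ⊗ S) ⊗ Y ⇉ X ⊗ Y` this unfolds to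
`IsRelativeTensor`. -/
def IsCoequalizer {X Y Z : C} (f g : X ⟶ Y) (q : Y ⟶ Z) : Prop :=
  ∃ h : f ≫ q = g ≫ q, Nonempty (IsColimit (Cofork.ofπ q h))

namespace IsCoequalizer

variable {X Y Z X' Y' Z' : C} {f g : X ⟶ Y} {q : Y ⟶ Z} {f' g' : X' ⟶ Y'} {q' : Y' ⟶ Z'}

lemma w (h : IsCoequalizer f g q) : f ≫ q = g ≫ q := h.choose

lemma exists_desc (h : IsCoequalizer f g q) {W : C} (k : Y ⟶ W) (hk : f ≫ k = g ≫ k) :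
    ∃ d : Z ⟶ W, q ≫ d = k := by
  obtain ⟨_, ⟨hl⟩⟩ := h
  exact ⟨Cofork.IsColimit.desc hl k hk, Cofork.IsColimit.π_desc' hl k hk⟩

lemma epi (h : IsCoequalizer f g q) : Epi q := by
  obtain ⟨_, ⟨hl⟩⟩ := h
  exact ⟨fun a b hab => Cofork.IsColimit.hom_ext hl hab⟩

lemma of_exists_desc (hq : Epi q) (hw : f ≫ q = g ≫ q)
    (hd : ∀ {W : C} (k : Y ⟶ W), f ≫ k = g ≫ k → ∃ d : Z ⟶ W, q ≫ d = k) :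
    IsCoequalizer f g q :=
  ⟨hw, ⟨Cofork.IsColimit.mk _ (fun s => (hd s.π s.condition).choose)
    (fun s => (hd s.π s.condition).choose_spec)
    (fun s _ hm => (cancel_epi q).1 (hm.trans (hd s.π s.condition).choose_spec.symm))⟩⟩

lemma ofHasCoequalizer [HasCoequalizer f g] : IsCoequalizer f g (coequalizer.π f g) :=
  ⟨coequalizer.condition f g, ⟨coequalizerIsCoequalizer f g⟩⟩

/-- Precomposing the parallel pair with an epimorphism and replacing the cofork by an isomorphic
one does not affect being a coequalizer. -/
lemma of_iso (h : IsCoequalizer f g q) (x : X' ⟶ X) (hx : Epi x) (y : Y' ⟶ Y) (hy : IsIso y)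
    (z : Z' ⟶ Z) (hz : IsIso z) (hf : f' ≫ y = x ≫ f) (hg : g' ≫ y = x ≫ g)
    (hq : q' ≫ z = y ≫ q) : IsCoequalizer f' g' q' := by
  have hepi := h.epi
  have hq' : q' = y ≫ q ≫ inv z := by rw [← Category.assoc, ← hq]; simp
  refine of_exists_desc ?_ ?_ ?_
  · rw [hq']; infer_instance
  · rw [hq', reassoc_of% hf, reassoc_of% hg, reassoc_of% h.w]
  · intro W k hk
    have hf'' : f' = x ≫ f ≫ inv y := by rw [← Category.assoc, ← hf]; simp
    have hg'' : g' = x ≫ g ≫ inv y := by rw [← Category.assoc, ← hg]; simp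
    simp only [hf'', hg'', Category.assoc, cancel_epi] at hk
    obtain ⟨d, hd⟩ := h.exists_desc (inv y ≫ k) hk
    exact ⟨z ≫ d, by rw [reassoc_of% hq, hd]; simp⟩

lemma isIso_of_comm (h : IsCoequalizer f g q) (h' : IsCoequalizer f' g' q')
    (x : X' ⟶ X) (hx : Epi x) (y : Y' ⟶ Y) (hy : IsIso y) (z : Z' ⟶ Z)
    (hf : f' ≫ y = x ≫ f) (hg : g' ≫ y = x ≫ g) (hq : q' ≫ z = y ≫ q) : IsIso z := by
  have hepi := h.epi
  have hepi' := h'.epi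
  have hw : f ≫ inv y ≫ q' = g ≫ inv y ≫ q' := by
    rw [← cancel_epi x, ← reassoc_of% hf, ← reassoc_of% hg]
    simpa using h'.w
  obtain ⟨d, hd⟩ := h.exists_desc (inv y ≫ q') hw
  refine ⟨d, ?_, ?_⟩
  · rw [← cancel_epi q', reassoc_of% hq, hd]; simp
  · rw [← cancel_epi q, reassoc_of% hd, hq]; simp

lemma exists_iso_of_comm (h : IsCoequalizer f g q) (h' : IsCoequalizer f' g' q')
    (x : X' ⟶ X) (hx : Epi x) (y : Y' ⟶ Y) (hy : IsIso y)
    (hf : f' ≫ y = x ≫ f) (hg : g' ≫ y = x ≫ g) :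
    ∃ z : Z' ≅ Z, q' ≫ z.hom = y ≫ q := by
  obtain ⟨d, hd⟩ := h'.exists_desc (y ≫ q) (by
    rw [reassoc_of% hf, reassoc_of% hg, h.w])
  have := isIso_of_comm h h' x hx y hy d hf hg hd
  exact ⟨asIso d, hd⟩

lemma map {D : Type u₂} [Category.{v} D] (h : IsCoequalizer f g q) (G : C ⥤ D)
    [PreservesColimitsOfShape WalkingParallelPair G] :
    IsCoequalizer (G.map f) (G.map g) (G.map q) := by
  obtain ⟨hw, ⟨hl⟩⟩ := h
  exact ⟨by rw [← G.map_comp, hw, G.map_comp],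
    ⟨isColimitCoforkMapOfIsColimit G hw hl⟩⟩

lemma of_map {D : Type u₂} [Category.{v} D] (G : C ⥤ D) [HasColimitsOfShape WalkingParallelPair C]
    [PreservesColimitsOfShape WalkingParallelPair G] [G.ReflectsIsomorphisms]
    (hw : f ≫ q = g ≫ q) (h : IsCoequalizer (G.map f) (G.map g) (G.map q)) :
    IsCoequalizer f g q := by
  have := reflectsColimitsOfShape_of_reflectsIsomorphisms (J := WalkingParallelPair) (G := G)
  obtain ⟨_, ⟨hl⟩⟩ := h
  exact ⟨hw, ⟨isColimitOfIsColimitCoforkMap G hw hl⟩⟩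

lemma of_splitting {f g : X ⟶ Y} {q : Y ⟶ Z} (s : IsSplitCoequalizer f g q) :
    IsCoequalizer f g q :=
  ⟨s.condition, ⟨s.isCoequalizer⟩⟩

end IsCoequalizer

end Coequalizers

section Size

variable {C : Type u₁} [Category.{v} C] {D : Type u₂} [Category.{v} D]

lemma hasCoequalizers_of_isLocallyFinitelyPresentable
    (h : IsLocallyFinitelyPresentable.{v} C) : HasCoequalizers C :=
  have : HasColimitsOfSize.{v, v} C := h.toHasColimitsOfSize
  have : HasColimitsOfSize.{0, 0} C := hasSmallestColimitsOfHasColimits C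
  inferInstance

lemma preservesCoequalizers_of_cocontinuous (G : C ⥤ D) (h : PreservesColimitsOfSize.{v, v} G) :
    PreservesColimitsOfShape WalkingParallelPair G :=
  have : PreservesColimitsOfSize.{0, 0} G := preservesSmallestColimits_of_preservesColimits G
  inferInstance

attribute [local instance] Cardinal.fact_isRegular_aleph0 in
/-- Every object is a colimit of compact ones, so a natural transformation between cocontinuous
functors is invertible as soon as its components at compact objects are. -/
lemma isIso_app_of_isIso_app_compact (hC : IsLocallyFinitelyPresentable.{v} C) {G H : C ⥤ D}
    (hG : PreservesColimitsOfSize.{v, v} G) (hH : PreservesColimitsOfSize.{v, v} H) (t : G ⟶ H)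
    (ht : ∀ X : C, IsFinitelyPresentable.{v} X → IsIso (t.app X)) (X : C) : IsIso (t.app X) := by
  obtain ⟨P, _, hP⟩ := hC.exists_generator
  obtain ⟨J, _, _, ⟨p⟩⟩ := hP.exists_colimitsOfShape X
  have hiso : IsIso (whiskerLeft p.diag t) := by
    have (j : J) : IsIso ((whiskerLeft p.diag t).app j) :=
      ht _ (hP.le_isCardinalPresentable _ (p.prop_diag_obj j))
    exact NatIso.isIso_of_isIso_app _
  have hG' := isColimitOfPreserves G p.isColimit
  have hH' := isColimitOfPreserves H p.isColimit
  have e : t.app X = (IsColimit.coconePointsIsoOfNatIso hG' hH'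
      (asIso (whiskerLeft p.diag t))).hom := by
    refine hG'.hom_ext fun j => ?_
    rw [IsColimit.comp_coconePointsIsoOfNatIso_hom]
    simp
  rw [e]
  infer_instance

end Size

/-! ### Transport of actions and of linear functors along equivalences -/

section Transport

variable {B : Type u₂} [Category.{v} B] [MonoidalCategory B]
  {D : Type u₁} [Category.{v} D] [MonoidalRightAction B D]
  {D' : Type u₃} [Category.{v} D']

/-- The right action transported along an equivalence `E : D ≌ D'`: `X ⊙ᵣ b` is
`E (E⁻¹ X ⊙ᵣ b)`. -/
@[reducible]
def transportedRightAction (E : D ≌ D') : MonoidalRightAction B D' where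
  actionObj X b := E.functor.obj (E.inverse.obj X ⊙ᵣ b)
  actionHomLeft f b := E.functor.map (E.inverse.map f ⊵ᵣ b)
  actionHomRight X b c g := E.functor.map (E.inverse.obj X ⊴ᵣ g)
  actionAssocIso X b c :=
    E.functor.mapIso (αᵣ (E.inverse.obj X) b c ≪≫
      { hom := E.unit.app (E.inverse.obj X ⊙ᵣ b) ⊵ᵣ c
        inv := E.unitInv.app (E.inverse.obj X ⊙ᵣ b) ⊵ᵣ c
        hom_inv_id := by simp [← MonoidalRightAction.comp_actionHomLeft]
        inv_hom_id := by simp [← MonoidalRightAction.comp_actionHomLeft] })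
  actionUnitIso X := E.functor.mapIso (ρᵣ (E.inverse.obj X)) ≪≫ E.counitIso.app X
  actionHom_def f g := rfl
  actionHomRight_id b X := by
    simp
  id_actionHomLeft b X := by
    simp
  actionHom_comp f₁ f₂ g₁ g₂ := by
    simp only [← E.functor.map_comp, E.inverse.map_comp, MonoidalRightAction.comp_actionHomLeft,
      MonoidalRightAction.actionHomRight_comp, Category.assoc]
    rw [MonoidalRightAction.action_exchange_assoc]
  actionAssocIso_hom_naturality {X Y b b' c c'} f g h := by
    change (E.functor.map (E.inverse.map f ⊵ᵣ _) ≫ E.functor.map (_ ⊴ᵣ (g ⊗ₘ h))) ≫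
        E.functor.map (_ ≫ E.unit.app _ ⊵ᵣ c') =
      E.functor.map (_ ≫ E.unit.app _ ⊵ᵣ c) ≫
        E.functor.map (E.inverse.map (E.functor.map _ ≫ E.functor.map _) ⊵ᵣ c) ≫
          E.functor.map (_ ⊴ᵣ h)
    have h1 := MonoidalRightAction.actionAssocIso_hom_naturality (E.inverse.map f) g h
    rw [MonoidalRightAction.actionHom_def, MonoidalRightAction.actionHom_def,
      MonoidalRightAction.actionHom_def] at h1
    have h2 := E.unit.naturality (E.inverse.map f ⊵ᵣ b ≫ E.inverse.obj Y ⊴ᵣ g)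
    simp only [Functor.id_map, Functor.comp_map, Functor.id_obj, Functor.comp_obj] at h2
    simp only [← E.functor.map_comp]
    congr 1
    rw [Category.assoc] at h1
    simp only [Category.assoc]
    rw [reassoc_of% h1, MonoidalRightAction.action_exchange,
      ← MonoidalRightAction.comp_actionHomLeft_assoc, h2,
      MonoidalRightAction.comp_actionHomLeft_assoc]
    rfl
  actionUnitIso_hom_naturality f := by
    change (E.functor.map (ρᵣ _).hom ≫ E.counit.app _) ≫ f =
      E.functor.map (E.inverse.map f ⊵ᵣ _) ≫ E.functor.map (ρᵣ _).hom ≫ E.counit.app _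
    rw [← E.functor.map_comp_assoc, ← MonoidalRightAction.actionUnitIso_hom_naturality]
    simp
  actionHomRight_whiskerRight {b b'} f c X := by
    change E.functor.map _ = E.functor.map (_ ≫ E.unit.app _ ⊵ᵣ c) ≫
      E.functor.map (E.inverse.map (E.functor.map _) ⊵ᵣ c) ≫
        E.functor.map (E.unitInv.app _ ⊵ᵣ c ≫ _)
    simp only [← E.functor.map_comp]
    congr 1
    have h2 := E.unit.naturality (E.inverse.obj X ⊴ᵣ f)
    simp only [Functor.id_map, Functor.comp_map, Functor.id_obj, Functor.comp_obj] at h2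
    rw [Category.assoc, ← MonoidalRightAction.comp_actionHomLeft_assoc, ← h2]
    simp [← MonoidalRightAction.comp_actionHomLeft_assoc, -MonoidalRightAction.comp_actionHomLeft]
  whiskerRight_actionHomLeft b {c c'} f X := by
    change E.functor.map _ = E.functor.map (_ ≫ E.unit.app _ ⊵ᵣ c) ≫
      E.functor.map (_ ⊴ᵣ f) ≫ E.functor.map (E.unitInv.app _ ⊵ᵣ c' ≫ _)
    simp only [← E.functor.map_comp]
    congr 1
    rw [Category.assoc, MonoidalRightAction.whiskerRight_actionHomLeft,
      MonoidalRightAction.action_exchange_assoc, ← MonoidalRightAction.comp_actionHomLeft_assoc]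
    simp
  actionHom_associator b₁ b₂ b₃ X := by
    change E.functor.map (_ ⊴ᵣ _) ≫ E.functor.map (_ ≫ E.unit.app _ ⊵ᵣ _) ≫
      E.functor.map (_ ≫ E.unit.app _ ⊵ᵣ _) =
      E.functor.map (_ ≫ E.unit.app _ ⊵ᵣ _) ≫
        E.functor.map (E.inverse.map (E.functor.map (_ ≫ E.unit.app _ ⊵ᵣ _)) ⊵ᵣ _)
    simp only [← E.functor.map_comp]
    congr 1
    have h2 := E.unit.naturality ((αᵣ (E.inverse.obj X) b₁ b₂).hom ≫
      E.unit.app (E.inverse.obj X ⊙ᵣ b₁) ⊵ᵣ b₂)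
    simp only [Functor.id_map, Functor.comp_map, Functor.id_obj, Functor.comp_obj] at h2
    rw [Category.assoc _ (E.unit.app _ ⊵ᵣ b₃), ← MonoidalRightAction.comp_actionHomLeft, ← h2]
    have h3 := MonoidalRightAction.actionHom_associator b₁ b₂ b₃ (E.inverse.obj X)
    have h4 : (E.unit.app (E.inverse.obj X ⊙ᵣ b₁)) ⊵ᵣ (b₂ ⊗ b₃) ≫ (αᵣ _ b₂ b₃).hom =
        (αᵣ _ b₂ b₃).hom ≫ (E.unit.app (E.inverse.obj X ⊙ᵣ b₁) ⊵ᵣ b₂) ⊵ᵣ b₃ := by simp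
    simp only [Category.assoc]
    rw [reassoc_of% h4, reassoc_of% h3]
    simp
  actionHom_leftUnitor b X := by
    change E.functor.map (_ ⊴ᵣ _) = E.functor.map (_ ≫ E.unit.app _ ⊵ᵣ _) ≫
      E.functor.map (E.inverse.map (E.functor.map _ ≫ E.counit.app _) ⊵ᵣ _)
    rw [← E.functor.map_comp]
    congr 1
    have h2 := E.unit.naturality (ρᵣ[B] (E.inverse.obj X)).hom
    simp only [Functor.id_map, Functor.comp_map, Functor.id_obj, Functor.comp_obj] at h2
    rw [Category.assoc, ← MonoidalRightAction.comp_actionHomLeft, E.inverse.map_comp,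
      ← reassoc_of% h2, MonoidalRightAction.actionHom_leftUnitor]
    simp
  actionHom_rightUnitor b X := by
    change E.functor.map (_ ⊴ᵣ _) = E.functor.map (_ ≫ E.unit.app _ ⊵ᵣ _) ≫
      E.functor.map (ρᵣ _).hom ≫ E.counit.app _
    rw [MonoidalRightAction.actionHom_rightUnitor, ← E.functor.map_comp_assoc, Category.assoc,
      ← MonoidalRightAction.actionUnitIso_hom_naturality]
    simp

/-- An equivalence is linear for the action transported along it. -/
@[reducible]
def transportedRightActionRightLinear (E : D ≌ D') :
    letI := transportedRightAction (B := B) E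
    E.functor.RightLinear B :=
  letI := transportedRightAction (B := B) E
  { μᵣ d b := E.functor.map (E.unitInv.app d ⊵ᵣ b)
    δᵣ d b := E.functor.map (E.unit.app d ⊵ᵣ b)
    μᵣ_naturality_right d {c c'} f := by
      change E.functor.map (_ ⊴ᵣ f) ≫ _ = _
      simp only [← E.functor.map_comp, MonoidalRightAction.action_exchange]
      rfl
    μᵣ_naturality_left f c := by
      change E.functor.map (E.inverse.map (E.functor.map f) ⊵ᵣ c) ≫ _ = _
      simp only [← E.functor.map_comp, ← MonoidalRightAction.comp_actionHomLeft]
      congr 2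
      exact E.unitInv.naturality f
    μᵣ_associativity d b c := by
      change _ = E.functor.map (_ ≫ E.unit.app _ ⊵ᵣ _) ≫
        E.functor.map (E.inverse.map (E.functor.map _) ⊵ᵣ _) ≫ E.functor.map _
      simp only [← E.functor.map_comp]
      congr 1
      have h2 := E.unitInv.naturality (E.unitInv.app d ⊵ᵣ b)
      simp only [Functor.id_map, Functor.comp_map, Functor.id_obj, Functor.comp_obj] at h2
      have h3 : E.unit.app (E.inverse.obj (E.functor.obj d) ⊙ᵣ b) ≫
          E.unitInv.app (E.inverse.obj (E.functor.obj d) ⊙ᵣ b) = 𝟙 _ :=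
        E.unitIso.hom_inv_id_app _
      rw [Category.assoc, ← MonoidalRightAction.comp_actionHomLeft, h2,
        MonoidalRightAction.comp_actionHomLeft, ← MonoidalRightAction.comp_actionHomLeft_assoc, h3]
      simp
    μᵣ_unitality d := by
      change E.functor.map _ ≫ E.counit.app _ = _
      rw [← E.functor.map_comp, ← MonoidalRightAction.actionUnitIso_hom_naturality,
        E.functor.map_comp, E.counit_app_functor]
      rfl
    δᵣ_naturality_right d {c c'} f := by
      change _ = _ ≫ E.functor.map (_ ⊴ᵣ f)
      simp only [← E.functor.map_comp, MonoidalRightAction.action_exchange]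
      rfl
    δᵣ_naturality_left f c := by
      change _ = _ ≫ E.functor.map (E.inverse.map (E.functor.map f) ⊵ᵣ c)
      simp only [← E.functor.map_comp, ← MonoidalRightAction.comp_actionHomLeft]
      congr 2
      exact E.unit.naturality f
    δᵣ_associativity d b c := by
      change _ ≫ E.functor.map (_ ≫ E.unit.app _ ⊵ᵣ _) = _ ≫ _ ≫
        E.functor.map (E.inverse.map (E.functor.map _) ⊵ᵣ _)
      simp only [← E.functor.map_comp]
      congr 1
      have h2 := E.unit.naturality (E.unit.app d ⊵ᵣ b)
      simp only [Functor.id_map, Functor.comp_map, Functor.id_obj, Functor.comp_obj] at h2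
      rw [← MonoidalRightAction.comp_actionHomLeft, ← h2]
      simp
    δᵣ_unitality_inv d := by
      change E.counitInv.app _ ≫ E.functor.map _ = _
      rw [← E.functor.map_comp, MonoidalRightAction.actionUnitIso_inv_naturality,
        E.functor.map_comp, E.counitInv_app_functor]
      rfl
    μᵣ_comp_δᵣ d b := by
      rw [← E.functor.map_comp, ← MonoidalRightAction.comp_actionHomLeft]
      simp
      rfl
    δᵣ_comp_μᵣ d b := by
      rw [← E.functor.map_comp, ← MonoidalRightAction.comp_actionHomLeft]
      simp }

/-- A lax linear functor whose structure morphisms are invertible is linear. -/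
@[reducible]
noncomputable def rightLinearOfLax (G : D ⥤ D') [MonoidalRightAction B D']
    (L : G.LaxRightLinear B) (hL : ∀ (d : D) (b : B), IsIso (LaxRightLinear.μᵣ G d b)) :
    G.RightLinear B where
  toLaxRightLinear := L
  δᵣ d b := inv (LaxRightLinear.μᵣ G d b)
  δᵣ_naturality_right d {b c} f := by
    rw [IsIso.comp_inv_eq, Category.assoc, IsIso.eq_inv_comp,
      LaxRightLinear.μᵣ_naturality_right]
  δᵣ_naturality_left f b := by
    rw [IsIso.comp_inv_eq, Category.assoc, IsIso.eq_inv_comp,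
      LaxRightLinear.μᵣ_naturality_left]
  δᵣ_associativity d b c := by
    rw [IsIso.inv_comp_eq, ← cancel_mono (LaxRightLinear.μᵣ G d b ⊵ᵣ c),
      ← cancel_mono (LaxRightLinear.μᵣ G (d ⊙ᵣ b) c)]
    simp
  δᵣ_unitality_inv d := by
    rw [← cancel_mono (LaxRightLinear.μᵣ G d (𝟙_ B))]
    simp
  μᵣ_comp_δᵣ d b := IsIso.hom_inv_id _
  δᵣ_comp_μᵣ d b := IsIso.inv_hom_id _

variable {D'' : Type u} [Category.{v} D''] [MonoidalRightAction B D'] [MonoidalRightAction B D'']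
  {G : D ⥤ D'} [G.RightLinear B] {H : D ⥤ D''} [H.RightLinear B]
  {Φ : D' ⥤ D''} (e : G ⋙ Φ ≅ H)

/-- Given linear functors `G` and `H` with `G ⋙ Φ ≅ H`, the linear structure morphisms of `Φ` at the
objects in the image of `G`. -/
def lineatorOnImage (d : D) (b : B) : Φ.obj (G.obj d) ⊙ᵣ b ⟶ Φ.obj (G.obj d ⊙ᵣ b) :=
  e.hom.app d ⊵ᵣ b ≫ LaxRightLinear.μᵣ H d b ≫ e.inv.app (d ⊙ᵣ b) ≫
    Φ.map (OplaxRightLinear.δᵣ G d b)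

lemma lineatorOnImage_naturality_left {d d' : D} (f : d ⟶ d') (b : B) :
    Φ.map (G.map f) ⊵ᵣ b ≫ lineatorOnImage e d' b =
      lineatorOnImage e d b ≫ Φ.map (G.map f ⊵ᵣ b) := by
  have h1 := e.hom.naturality f
  have h2 := e.inv.naturality (f ⊵ᵣ b)
  simp only [Functor.comp_map] at h1 h2
  simp only [lineatorOnImage, Category.assoc]
  rw [← MonoidalRightAction.comp_actionHomLeft_assoc, h1,
    MonoidalRightAction.comp_actionHomLeft_assoc, LaxRightLinear.μᵣ_naturality_left_assoc,
    reassoc_of% h2, ← Φ.map_comp, ← Φ.map_comp, OplaxRightLinear.δᵣ_naturality_left]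

lemma lineatorOnImage_naturality_right (d : D) {b c : B} (f : b ⟶ c) :
    Φ.obj (G.obj d) ⊴ᵣ f ≫ lineatorOnImage e d c =
      lineatorOnImage e d b ≫ Φ.map (G.obj d ⊴ᵣ f) := by
  have h2 := e.inv.naturality (d ⊴ᵣ f)
  simp only [Functor.comp_map] at h2
  simp only [lineatorOnImage, Category.assoc]
  erw [MonoidalRightAction.action_exchange_assoc]
  rw [LaxRightLinear.μᵣ_naturality_right_assoc, reassoc_of% h2, ← Φ.map_comp, ← Φ.map_comp,
    OplaxRightLinear.δᵣ_naturality_right]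

lemma lineatorOnImage_comp_map (d : D) (b : B) :
    lineatorOnImage e d b ≫ Φ.map (LaxRightLinear.μᵣ G d b) =
      e.hom.app d ⊵ᵣ b ≫ LaxRightLinear.μᵣ H d b ≫ e.inv.app (d ⊙ᵣ b) := by
  simp [lineatorOnImage, ← Φ.map_comp]

instance (d : D) (b : B) : IsIso (lineatorOnImage e d b) := by
  unfold lineatorOnImage
  infer_instance

variable [G.IsEquivalence]

/-- The linear structure morphisms of a functor `Φ` such that `G ⋙ Φ ≅ H`, for linear functors `G`
and `H` of which `G` is an equivalence. -/
noncomputable def lineatorOfComp (X : D') (b : B) : Φ.obj X ⊙ᵣ b ⟶ Φ.obj (X ⊙ᵣ b) :=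
  Φ.map (G.objObjPreimageIso X).inv ⊵ᵣ b ≫ lineatorOnImage e (G.objPreimage X) b ≫
    Φ.map ((G.objObjPreimageIso X).hom ⊵ᵣ b)

/-- `lineatorOfComp` does not depend on the chosen preimage: any morphism to an object in the image
of `G` computes it. -/
lemma lineatorOfComp_naturality_image {X : D'} {d : D} (i : X ⟶ G.obj d) (b : B) :
    Φ.map i ⊵ᵣ b ≫ lineatorOnImage e d b = lineatorOfComp e X b ≫ Φ.map (i ⊵ᵣ b) := by
  obtain ⟨f, hf⟩ := G.map_surjective ((G.objObjPreimageIso X).hom ≫ i)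
  have hi : i = (G.objObjPreimageIso X).inv ≫ G.map f := by simp [hf]
  rw [lineatorOfComp, Category.assoc, Category.assoc, ← Φ.map_comp,
    ← MonoidalRightAction.comp_actionHomLeft, ← hf, ← lineatorOnImage_naturality_left,
    ← MonoidalRightAction.comp_actionHomLeft_assoc, ← Φ.map_comp, ← hi]

lemma lineatorOfComp_naturality_left {X Y : D'} (f : X ⟶ Y) (b : B) :
    Φ.map f ⊵ᵣ b ≫ lineatorOfComp e Y b = lineatorOfComp e X b ≫ Φ.map (f ⊵ᵣ b) := by
  let i := (G.objObjPreimageIso Y).symm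
  have h1 := lineatorOfComp_naturality_image e i.hom b
  have h2 := lineatorOfComp_naturality_image e (f ≫ i.hom) b
  rw [← cancel_mono (Φ.map (i.hom ⊵ᵣ b))]
  rw [Category.assoc, Category.assoc, ← h1]
  rw [← MonoidalRightAction.comp_actionHomLeft_assoc, ← Φ.map_comp, ← Φ.map_comp,
    ← MonoidalRightAction.comp_actionHomLeft]
  exact h2

instance (X : D') (b : B) : IsIso (lineatorOfComp e X b) := by
  unfold lineatorOfComp
  infer_instance

/-- If `G` and `H` are linear, `G` is an equivalence and `G ⋙ Φ ≅ H`, then `Φ` is linear. -/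
@[reducible]
noncomputable def rightLinearOfComp : Φ.RightLinear B :=
  rightLinearOfLax Φ
    { μᵣ := lineatorOfComp e
      μᵣ_naturality_left := lineatorOfComp_naturality_left e
      μᵣ_naturality_right X {b c} f := by
        let i := (G.objObjPreimageIso X).symm
        have h1 := lineatorOfComp_naturality_image e i.hom b
        have h2 := lineatorOfComp_naturality_image e i.hom c
        have h3 := MonoidalRightAction.action_exchange i.hom f
        rw [← cancel_mono (Φ.map (i.hom ⊵ᵣ c)), Category.assoc, ← h2, Category.assoc,
          ← Φ.map_comp, h3, Φ.map_comp, ← reassoc_of% h1,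
          MonoidalRightAction.action_exchange_assoc]
        congr 1
        exact lineatorOnImage_naturality_right e _ f
      μᵣ_associativity X b c := by
        let d := G.objPreimage X
        let i : X ≅ G.obj d := (G.objObjPreimageIso X).symm
        -- the case `X = G d`, where it follows from associativity for `G` and `H`
        have hobj : lineatorOnImage e d (b ⊗ c) ≫ Φ.map (αᵣ (G.obj d) b c).hom =
            (αᵣ (Φ.obj (G.obj d)) b c).hom ≫ lineatorOnImage e d b ⊵ᵣ c ≫
              lineatorOfComp e (G.obj d ⊙ᵣ b) c := by
          have h1 := lineatorOfComp_naturality_image e (LaxRightLinear.μᵣ G d b) c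
          rw [← cancel_mono (Φ.map (LaxRightLinear.μᵣ G d b ⊵ᵣ c))]
          simp only [Category.assoc]
          rw [← h1, ← MonoidalRightAction.comp_actionHomLeft_assoc, lineatorOnImage_comp_map,
            ← cancel_mono (Φ.map (LaxRightLinear.μᵣ G (d ⊙ᵣ b) c))]
          simp only [Category.assoc]
          rw [lineatorOnImage_comp_map, ← Φ.map_comp, ← Φ.map_comp,
            ← LaxRightLinear.μᵣ_associativity, Φ.map_comp,
            reassoc_of% (lineatorOnImage_comp_map e d (b ⊗ c))]
          have h2 := e.inv.naturality (αᵣ d b c).hom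
          simp only [Functor.comp_map] at h2
          rw [← h2]
          simp only [MonoidalRightAction.comp_actionHomLeft, Category.assoc]
          rw [← MonoidalRightAction.comp_actionHomLeft_assoc (e.inv.app _),
            Iso.inv_hom_id_app, MonoidalRightAction.id_actionHomLeft, Category.id_comp,
            LaxRightLinear.μᵣ_associativity_assoc]
          have h3 := MonoidalRightAction.actionAssocIso_hom_naturality (e.hom.app d) (𝟙 b) (𝟙 c)
          simp only [MonoidalRightAction.actionHom_id, id_tensorHom_id] at h3
          rw [reassoc_of% h3]
        rw [← cancel_mono (Φ.map ((i.hom ⊵ᵣ b) ⊵ᵣ c))]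
        simp only [Category.assoc]
        rw [← lineatorOfComp_naturality_left, ← MonoidalRightAction.comp_actionHomLeft_assoc,
          ← lineatorOfComp_naturality_image, MonoidalRightAction.comp_actionHomLeft_assoc]
        have h3 := MonoidalRightAction.actionAssocIso_hom_naturality i.hom (𝟙 b) (𝟙 c)
        have h4 := MonoidalRightAction.actionAssocIso_hom_naturality (Φ.map i.hom) (𝟙 b) (𝟙 c)
        simp only [MonoidalRightAction.actionHom_id, id_tensorHom_id] at h3 h4
        rw [← reassoc_of% h4, ← hobj, ← Φ.map_comp, ← h3, Φ.map_comp,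
          ← reassoc_of% (lineatorOfComp_naturality_image e i.hom)]
      μᵣ_unitality X := by
        let d := G.objPreimage X
        let i : X ≅ G.obj d := (G.objObjPreimageIso X).symm
        rw [← cancel_mono (Φ.map i.hom), MonoidalRightAction.actionUnitIso_hom_naturality,
          Category.assoc, ← Φ.map_comp, MonoidalRightAction.actionUnitIso_hom_naturality,
          Φ.map_comp, ← reassoc_of% (lineatorOfComp_naturality_image e i.hom)]
        congr 1
        have h2 := e.inv.naturality (ρᵣ[B] d).hom
        simp only [Functor.comp_map] at h2
        rw [lineatorOnImage]
        simp only [Category.assoc]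
        rw [← Φ.map_comp, OplaxRightLinear.δᵣ_unitality_hom, ← h2,
          ← LaxRightLinear.μᵣ_unitality_assoc,
          ← MonoidalRightAction.actionUnitIso_hom_naturality_assoc]
        simp }
    (fun X b => by
      change IsIso (lineatorOfComp e X b)
      infer_instance)

end Transport

/-! ### The projection formula for internal homs -/

section HomCalculus

variable {C : Type u₁} [Category.{v} C] {B : Type u₂} [Category.{v} B] [MonoidalCategory B]
  {D : Type u₃} [Category.{v} D] [MonoidalRightAction B D]
  {F : C ⥤ B} {m : D} {R : D ⥤ C} (adj : act F m ⊣ R)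

lemma map_comp_spec {c c' : C} (f : c ⟶ c') {N : D} (g : c' ⟶ R.obj N) :
    m ⊴ᵣ F.map (f ≫ g) ≫ evHom adj N = m ⊴ᵣ F.map f ≫ m ⊴ᵣ F.map g ≫ evHom adj N := by
  rw [F.map_comp, MonoidalRightAction.actionHomRight_comp, Category.assoc]

lemma map_comp_map_spec {c : C} {N N' : D} (g : c ⟶ R.obj N) (h : N ⟶ N') :
    m ⊴ᵣ F.map (g ≫ R.map h) ≫ evHom adj N' = (m ⊴ᵣ F.map g ≫ evHom adj N) ≫ h := by
  rw [map_comp_spec, evHom_naturality, Category.assoc]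

end HomCalculus

section TensorHom

variable {C : Type u₁} [Category.{v} C] [MonoidalCategory C]
  {B : Type u₂} [Category.{v} B] [MonoidalCategory B]
  {D : Type u₃} [Category.{v} D] [MonoidalRightAction B D]
  {F : C ⥤ B} [F.Monoidal] {m : D} {R : D ⥤ C} (adj : act F m ⊣ R)

lemma actAssoc_naturality_left (d : D) {c c' : C} (f : c ⟶ c') (x : C) :
    d ⊴ᵣ F.map (f ▷ x) ≫ actAssoc F d c' x =
      actAssoc F d c x ≫ (d ⊴ᵣ F.map f) ⊵ᵣ F.obj x := by
  simpa using actAssoc_naturality F (d := d) f (𝟙 x)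

lemma actAssoc_naturality_right (d : D) (x : C) {c c' : C} (f : c ⟶ c') :
    d ⊴ᵣ F.map (x ◁ f) ≫ actAssoc F d x c' =
      actAssoc F d x c ≫ (d ⊙ᵣ F.obj x) ⊴ᵣ F.map f := by
  simpa [-MonoidalRightAction.action_actionHomRight] using actAssoc_naturality F (d := d) (𝟙 x) f

lemma actUnit_naturality {d d' : D} (f : d ⟶ d') :
    f ⊵ᵣ F.obj (𝟙_ C) ≫ actUnit F d' = actUnit F d ≫ f := by
  rw [actUnit, actUnit, ← MonoidalRightAction.action_exchange_assoc, Category.assoc,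
    MonoidalRightAction.actionUnitIso_hom_naturality]

instance (d : D) (c c' : C) : IsIso (actAssoc F d c c') := by
  unfold actAssoc; infer_instance

instance (d : D) : IsIso (actUnit F d) := by
  unfold actUnit; infer_instance

lemma tensorHomMap_spec (N : D) (c : C) :
    m ⊴ᵣ F.map (tensorHomMap adj N c) ≫ evHom adj (N ⊙ᵣ F.obj c) =
      actAssoc F m (R.obj N) c ≫ evHom adj N ⊵ᵣ F.obj c :=
  curryHom_spec adj _

lemma internalComp_spec (N : D) :
    m ⊴ᵣ F.map (internalComp adj N) ≫ evHom adj N =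
      actAssoc F m (R.obj m) (R.obj N) ≫ evHom adj m ⊵ᵣ F.obj (R.obj N) ≫ evHom adj N :=
  curryHom_spec adj _

lemma internalId_spec : m ⊴ᵣ F.map (internalId adj) ≫ evHom adj m = actUnit F m :=
  curryHom_spec adj _

lemma internalComp_eq (N : D) :
    internalComp adj N = tensorHomMap adj m (R.obj N) ≫ R.map (evHom adj N) := by
  apply internalHom_ext adj
  rw [internalComp_spec, map_comp_map_spec, tensorHomMap_spec, Category.assoc]

lemma tensorHomMap_naturality_left {N N' : D} (f : N ⟶ N') (c : C) :
    R.map f ▷ c ≫ tensorHomMap adj N' c = tensorHomMap adj N c ≫ R.map (f ⊵ᵣ F.obj c) := by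
  apply internalHom_ext adj
  rw [map_comp_spec, tensorHomMap_spec, map_comp_map_spec, tensorHomMap_spec,
    reassoc_of% (actAssoc_naturality_left (F := F)), ← MonoidalRightAction.comp_actionHomLeft,
    evHom_naturality, MonoidalRightAction.comp_actionHomLeft, Category.assoc]

lemma tensorHomMap_naturality_right (N : D) {c c' : C} (f : c ⟶ c') :
    R.obj N ◁ f ≫ tensorHomMap adj N c' = tensorHomMap adj N c ≫ R.map (N ⊴ᵣ F.map f) := by
  apply internalHom_ext adj
  rw [map_comp_spec, tensorHomMap_spec, map_comp_map_spec, tensorHomMap_spec,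
    reassoc_of% (actAssoc_naturality_right (F := F)), MonoidalRightAction.action_exchange,
    Category.assoc]

lemma tensorHomMap_assoc (N : D) (c c' : C) :
    tensorHomMap adj N (c ⊗ c') ≫ R.map (actAssoc F N c c') =
      (α_ (R.obj N) c c').inv ≫ tensorHomMap adj N c ▷ c' ≫
        tensorHomMap adj (N ⊙ᵣ F.obj c) c' := by
  rw [← cancel_epi (α_ (R.obj N) c c').hom, Iso.hom_inv_id_assoc]
  apply internalHom_ext adj
  rw [map_comp_spec, map_comp_map_spec, tensorHomMap_spec, map_comp_spec, tensorHomMap_spec,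
    reassoc_of% (actAssoc_naturality_left (F := F)), ← MonoidalRightAction.comp_actionHomLeft,
    tensorHomMap_spec, MonoidalRightAction.comp_actionHomLeft, Category.assoc,
    actAssoc_naturality_obj, reassoc_of% (actAssoc_assoc F m)]

lemma tensorHomMap_unit (N : D) :
    tensorHomMap adj N (𝟙_ C) ≫ R.map (actUnit F N) = (ρ_ (R.obj N)).hom := by
  apply internalHom_ext adj
  rw [map_comp_map_spec, tensorHomMap_spec, Category.assoc, actUnit_naturality,
    ← actAssoc_rightUnit, Category.assoc]

lemma tensorHomMap_linear (N : D) (c : C) :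
    internalComp adj N ▷ c ≫ tensorHomMap adj N c =
      (α_ (R.obj m) (R.obj N) c).hom ≫ R.obj m ◁ tensorHomMap adj N c ≫
        internalComp adj (N ⊙ᵣ F.obj c) := by
  apply internalHom_ext adj
  rw [map_comp_spec, tensorHomMap_spec, map_comp_spec, map_comp_spec, internalComp_spec,
    reassoc_of% (actAssoc_naturality_left (F := F)), ← MonoidalRightAction.comp_actionHomLeft,
    internalComp_spec, reassoc_of% (actAssoc_naturality_right (F := F)),
    MonoidalRightAction.action_exchange_assoc, tensorHomMap_spec,
    MonoidalRightAction.comp_actionHomLeft, MonoidalRightAction.comp_actionHomLeft,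
    reassoc_of% (actAssoc_naturality_obj F (evHom adj m)), reassoc_of% (actAssoc_assoc F m)]

/-- The contraction `(N ◁ a) ◁ a' ⟶ N` for dual objects `a` and `a'`. -/
noncomputable def actContract (N : D) (a' a : C) [ExactPairing a' a] :
    (N ⊙ᵣ F.obj a) ⊙ᵣ F.obj a' ⟶ N :=
  inv (actAssoc F N a a') ≫ N ⊴ᵣ F.map (ε_ a' a) ≫ actUnit F N

lemma actContract_zigzag (N : D) (a' a : C) [ExactPairing a' a] :
    (N ⊙ᵣ F.obj a) ⊴ᵣ F.map (η_ a' a) ≫ actAssoc F (N ⊙ᵣ F.obj a) a' a ≫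
      actContract (F := F) N a' a ⊵ᵣ F.obj a = actUnit F (N ⊙ᵣ F.obj a) := by
  have h1 := actAssoc_assoc F N a a' a
  have h2 : actAssoc F N a a' ≫ actContract N a' a = N ⊴ᵣ F.map (ε_ a' a) ≫ actUnit F N := by
    simp [actContract]
  rw [← cancel_epi (actAssoc F N a (𝟙_ C)), ← reassoc_of% (actAssoc_naturality_right (F := F)),
    actAssoc_rightUnit]
  have h3 : actAssoc F N a (a' ⊗ a) ≫ actAssoc F (N ⊙ᵣ F.obj a) a' a =
      N ⊴ᵣ F.map (α_ a a' a).inv ≫ actAssoc F N (a ⊗ a') a ≫ actAssoc F N a a' ⊵ᵣ F.obj a := by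
    rw [← h1, ← MonoidalRightAction.actionHomRight_comp_assoc, ← F.map_comp]
    simp
  rw [reassoc_of% h3, ← MonoidalRightAction.comp_actionHomLeft, h2,
    MonoidalRightAction.comp_actionHomLeft, ← reassoc_of% (actAssoc_naturality_left (F := F)),
    actAssoc_leftUnit]
  simp only [← MonoidalRightAction.actionHomRight_comp, ← F.map_comp]
  rw [ExactPairing.coevaluation_evaluation_assoc]
  simp

/-- The projection formula `Hom(m, N) ⊗ a ≅ Hom(m, N ◁ a)` for dualizable `a`. The inverse is
`Hom(m, N ◁ a) ⟶ Hom(m, N ◁ a) ⊗ a' ⊗ a ⟶ Hom(m, (N ◁ a) ◁ a') ⊗ a ⟶ Hom(m, N) ⊗ a`. -/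
lemma isIso_tensorHomMap_of_exactPairing (N : D) (a' a : C) [ExactPairing a' a] :
    IsIso (tensorHomMap adj N a) := by
  refine ⟨(ρ_ _).inv ≫ R.obj (N ⊙ᵣ F.obj a) ◁ η_ a' a ≫ (α_ _ _ _).inv ≫
    (tensorHomMap adj (N ⊙ᵣ F.obj a) a' ≫ R.map (actContract N a' a)) ▷ a, ?_, ?_⟩
  · have h1 := tensorHomMap_assoc adj N a a'
    rw [rightUnitor_inv_naturality_assoc, ← whisker_exchange_assoc,
      associator_inv_naturality_left_assoc, ← comp_whiskerRight]
    have h2 : tensorHomMap adj N a ▷ a' ≫ tensorHomMap adj (N ⊙ᵣ F.obj a) a' ≫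
        R.map (actContract N a' a) =
        (α_ _ _ _).hom ≫ R.obj N ◁ ε_ a' a ≫ (ρ_ _).hom := by
      rw [← Iso.inv_comp_eq, ← reassoc_of% h1, ← tensorHomMap_unit adj,
        reassoc_of% (tensorHomMap_naturality_right adj), ← R.map_comp, ← R.map_comp]
      simp [actContract]
    rw [h2]
    have h3 := ExactPairing.coevaluation_evaluation a' a
    calc
      _ = R.obj N ◁ (ρ_ a).inv ≫ R.obj N ◁ (a ◁ η_ a' a ≫ (α_ a a' a).inv ≫ ε_ a' a ▷ a) ≫
          R.obj N ◁ (λ_ a).hom := by monoidal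
      _ = 𝟙 _ := by
        rw [h3]
        simp [← MonoidalCategory.whiskerLeft_comp]
  · simp only [Category.assoc, comp_whiskerRight]
    rw [tensorHomMap_naturality_left, ← reassoc_of% (tensorHomMap_assoc adj),
      ← R.map_comp, reassoc_of% (tensorHomMap_naturality_right adj), ← R.map_comp,
      actContract_zigzag, tensorHomMap_unit]
    simp

end TensorHom

section TensorHomRigid

variable {C : Type u₁} [Category.{v} C] [MonoidalCategory C]
  {B : Type u₂} [Category.{v} B] [MonoidalCategory B]
  {D : Type u₃} [Category.{v} D] [MonoidalRightAction B D]
  {F : C ⥤ B} [F.Monoidal] {m : D} {R : D ⥤ C} (adj : act F m ⊣ R)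

/-- The projection formula `Hom(m, N) ⊗ a ≅ Hom(m, N ◁ a)` for a rigid acting category: both sides
are cocontinuous in `a`, and compact objects are dualizable. -/
lemma isIso_tensorHomMap_of_isRigidPr (hC : IsTensorPr C) (hrigid : IsRigidPr C)
    (hF : PreservesColimitsOfSize.{v, v} F) (hR : PreservesColimitsOfSize.{v, v} R) (N : D)
    (hN : PreservesColimitsOfSize.{v, v} (MonoidalRightAction.actionLeft (C := B) N)) (a : C) :
    IsIso (tensorHomMap adj N a) := by
  let t : tensorLeft (R.obj N) ⟶ F ⋙ MonoidalRightAction.actionLeft (C := B) N ⋙ R :=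
    { app a := tensorHomMap adj N a
      naturality a a' f := tensorHomMap_naturality_right adj N f }
  refine isIso_app_of_isIso_app_compact hC.presentable (hC.cocontinuous_left _) inferInstance t
    (fun a ha => ?_) a
  obtain ⟨h⟩ := (hrigid a ha).1
  exact isIso_tensorHomMap_of_exactPairing adj N (ᘁa) a

end TensorHomRigid

section FreeRight

variable {A : Type u₁} [Category.{v} A] [MonoidalCategory A]
  {B : Type u₂} [Category.{v} B] [MonoidalCategory B]
  {F : A ⥤ B} [F.Monoidal] {R : B ⥤ A} (adj : act F (𝟙_ B) ⊣ R)

/-- The canonical morphism `a ⊗ R(b) ⟶ R(F(a) ⊗ b)`, the mirror image of `tensorHomMap` for the left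
action of `A` on `B`. -/
def tensorRightAdjoint (a : A) (b : B) : a ⊗ R.obj b ⟶ R.obj (F.obj a ⊗ b) :=
  curryHom adj ((λ_ _).hom ≫ OplaxMonoidal.δ F a _ ≫ F.obj a ◁ counitHom adj b)

lemma tensorRightAdjoint_spec (a : A) (b : B) :
    F.map (tensorRightAdjoint adj a b) ≫ counitHom adj _ =
      OplaxMonoidal.δ F a _ ≫ F.obj a ◁ counitHom adj b :=
  map_curryHom_counit adj _

lemma tensorRightAdjoint_naturality_left {a a' : A} (f : a ⟶ a') (b : B) :
    f ▷ R.obj b ≫ tensorRightAdjoint adj a' b =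
      tensorRightAdjoint adj a b ≫ R.map (F.map f ▷ b) := by
  apply homToRight_ext adj
  rw [F.map_comp, F.map_comp, Category.assoc, Category.assoc, tensorRightAdjoint_spec,
    counitHom_naturality, reassoc_of% (tensorRightAdjoint_spec adj),
    ← OplaxMonoidal.δ_natural_left_assoc, whisker_exchange]

lemma tensorRightAdjoint_naturality_right (a : A) {b b' : B} (f : b ⟶ b') :
    a ◁ R.map f ≫ tensorRightAdjoint adj a b' =
      tensorRightAdjoint adj a b ≫ R.map (F.obj a ◁ f) := by
  apply homToRight_ext adj
  rw [F.map_comp, F.map_comp, Category.assoc, Category.assoc, tensorRightAdjoint_spec,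
    counitHom_naturality, reassoc_of% (tensorRightAdjoint_spec adj),
    ← OplaxMonoidal.δ_natural_right_assoc, ← MonoidalCategory.whiskerLeft_comp,
    ← MonoidalCategory.whiskerLeft_comp, counitHom_naturality]

lemma tensorRightAdjoint_assoc (a a' : A) (b : B) :
    a ◁ tensorRightAdjoint adj a' b ≫ tensorRightAdjoint adj a (F.obj a' ⊗ b) =
      (α_ a a' (R.obj b)).inv ≫ tensorRightAdjoint adj (a ⊗ a') b ≫
        R.map (OplaxMonoidal.δ F a a' ▷ b ≫ (α_ _ _ _).hom) := by
  rw [← cancel_epi (α_ a a' (R.obj b)).hom, Iso.hom_inv_id_assoc]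
  apply homToRight_ext adj
  have h := OplaxMonoidal.associativity F a a' (R.obj b)
  simp only [F.map_comp, Category.assoc]
  rw [tensorRightAdjoint_spec, counitHom_naturality, reassoc_of% (tensorRightAdjoint_spec adj),
    ← OplaxMonoidal.δ_natural_right_assoc, ← MonoidalCategory.whiskerLeft_comp,
    tensorRightAdjoint_spec, MonoidalCategory.whiskerLeft_comp, ← reassoc_of% h,
    whisker_exchange_assoc]
  simp

lemma tensorRightAdjoint_unit (b : B) :
    tensorRightAdjoint adj (𝟙_ A) b ≫ R.map (OplaxMonoidal.η F ▷ b ≫ (λ_ b).hom) =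
      (λ_ (R.obj b)).hom := by
  apply homToRight_ext adj
  have h := OplaxMonoidal.left_unitality_hom F (R.obj b)
  rw [F.map_comp, Category.assoc, counitHom_naturality,
    reassoc_of% (tensorRightAdjoint_spec adj), ← h, whisker_exchange_assoc]
  simp

/-- The contraction `F(a') ⊗ (F(a) ⊗ b) ⟶ b` for dual objects `a` and `a'`. -/
noncomputable def tensorContract (a a' : A) [ExactPairing a a'] (b : B) :
    F.obj a' ⊗ F.obj a ⊗ b ⟶ b :=
  (α_ _ _ _).inv ≫ inv (OplaxMonoidal.δ F a' a) ▷ b ≫ F.map (ε_ a a') ▷ b ≫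
    OplaxMonoidal.η F ▷ b ≫ (λ_ b).hom

lemma tensorContract_zigzag (a a' : A) [ExactPairing a a'] (b : B) :
    F.map (η_ a a') ▷ (F.obj a ⊗ b) ≫ OplaxMonoidal.δ F a a' ▷ (F.obj a ⊗ b) ≫
      (α_ _ _ _).hom ≫ F.obj a ◁ tensorContract a a' b =
      OplaxMonoidal.η F ▷ (F.obj a ⊗ b) ≫ (λ_ _).hom := by
  have h3 := ExactPairing.evaluation_coevaluation a a'
  have h1 := OplaxMonoidal.associativity F a a' a
  have h4 : OplaxMonoidal.δ F (𝟙_ A) a ≫ F.map (η_ a a') ▷ F.obj a ≫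
      OplaxMonoidal.δ F a a' ▷ F.obj a ≫ (α_ _ _ _).hom ≫
      F.obj a ◁ inv (OplaxMonoidal.δ F a' a) ≫ F.obj a ◁ F.map (ε_ a a') ≫
      F.obj a ◁ OplaxMonoidal.η F ≫ (ρ_ _).hom =
        OplaxMonoidal.δ F (𝟙_ A) a ≫ OplaxMonoidal.η F ▷ F.obj a ≫ (λ_ _).hom := by
    rw [OplaxMonoidal.δ_natural_left_assoc, reassoc_of% h1,
      OplaxMonoidal.left_unitality_hom]
    rw [← MonoidalCategory.whiskerLeft_comp_assoc, IsIso.hom_inv_id,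
      MonoidalCategory.whiskerLeft_id, Category.id_comp,
      OplaxMonoidal.δ_natural_right_assoc, OplaxMonoidal.right_unitality_hom,
      ← F.map_comp, ← F.map_comp, ← F.map_comp, reassoc_of% h3]
    simp
  rw [cancel_epi] at h4
  calc
    _ = (α_ (F.obj (𝟙_ A)) (F.obj a) b).inv ≫ (F.map (η_ a a') ▷ F.obj a ≫
          OplaxMonoidal.δ F a a' ▷ F.obj a ≫ (α_ _ _ _).hom ≫
          F.obj a ◁ inv (OplaxMonoidal.δ F a' a) ≫ F.obj a ◁ F.map (ε_ a a') ≫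
          F.obj a ◁ OplaxMonoidal.η F ≫ (ρ_ _).hom) ▷ b := by
      rw [tensorContract]
      monoidal
    _ = _ := by
      rw [h4]
      monoidal

/-- The projection formula `a ⊗ R(b) ≅ R(F(a) ⊗ b)` for dualizable `a`. -/
lemma isIso_tensorRightAdjoint_of_exactPairing (a a' : A) [ExactPairing a a'] (b : B) :
    IsIso (tensorRightAdjoint adj a b) := by
  refine ⟨(λ_ _).inv ≫ η_ a a' ▷ R.obj (F.obj a ⊗ b) ≫ (α_ _ _ _).hom ≫
    a ◁ (tensorRightAdjoint adj a' (F.obj a ⊗ b) ≫ R.map (tensorContract a a' b)), ?_, ?_⟩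
  · have h1 := tensorRightAdjoint_assoc adj a' a b
    rw [leftUnitor_inv_naturality_assoc, whisker_exchange_assoc,
      associator_naturality_right_assoc, ← MonoidalCategory.whiskerLeft_comp]
    have h2 : a' ◁ tensorRightAdjoint adj a b ≫ tensorRightAdjoint adj a' (F.obj a ⊗ b) ≫
        R.map (tensorContract a a' b) =
        (α_ _ _ _).inv ≫ ε_ a a' ▷ R.obj b ≫ (λ_ _).hom := by
      rw [reassoc_of% h1, ← tensorRightAdjoint_unit adj,
        reassoc_of% (tensorRightAdjoint_naturality_left adj), ← R.map_comp, ← R.map_comp]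
      simp [tensorContract]
    rw [h2]
    have h3 := ExactPairing.evaluation_coevaluation a a'
    calc
      _ = (λ_ a).inv ▷ R.obj b ≫ (η_ a a' ▷ a ≫ (α_ a a' a).hom ≫ a ◁ ε_ a a') ▷ R.obj b ≫
          (ρ_ a).hom ▷ R.obj b := by monoidal
      _ = 𝟙 _ := by
        rw [h3]
        simp [← comp_whiskerRight]
  · simp only [Category.assoc, MonoidalCategory.whiskerLeft_comp]
    rw [tensorRightAdjoint_naturality_right, reassoc_of% (tensorRightAdjoint_assoc adj),
      Iso.hom_inv_id_assoc,
      ← R.map_comp, reassoc_of% (tensorRightAdjoint_naturality_left adj), ← R.map_comp,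
      Category.assoc, tensorContract_zigzag, tensorRightAdjoint_unit]
    simp

/-- The projection formula `a ⊗ R(b) ≅ R(F(a) ⊗ b)` for rigid `A`. -/
lemma isIso_tensorRightAdjoint_of_isRigidPr (hA : IsTensorPr A) (hB : IsTensorPr B)
    (hrigid : IsRigidPr A) (hF : PreservesColimitsOfSize.{v, v} F)
    (hR : PreservesColimitsOfSize.{v, v} R) (a : A) (b : B) :
    IsIso (tensorRightAdjoint adj a b) := by
  have := hB.cocontinuous_right b
  let t : tensorRight (R.obj b) ⟶ F ⋙ tensorRight b ⋙ R :=
    { app a := tensorRightAdjoint adj a b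
      naturality a a' f := tensorRightAdjoint_naturality_left adj f b }
  refine isIso_app_of_isIso_app_compact hA.presentable (hA.cocontinuous_right _) inferInstance t
    (fun a ha => ?_) a
  obtain ⟨h⟩ := (hrigid a ha).2
  exact isIso_tensorRightAdjoint_of_exactPairing adj a (aᘁ) b

/-- The canonical morphism `E ⊗ a ⟶ R(F(a))`, with the algebra `E` written as `R(𝟙)`. -/
def unitTensorHom (a : A) : R.obj (𝟙_ B) ⊗ a ⟶ R.obj (F.obj a) := freeLeft adj a

/-- The canonical morphism `a ⊗ E ⟶ R(F(a))`, with the algebra `E` written as `R(𝟙)`. -/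
def tensorUnitHom (a : A) : a ⊗ R.obj (𝟙_ B) ⟶ R.obj (F.obj a) := freeRight adj a

lemma unitTensorHom_spec (a : A) :
    F.map (unitTensorHom adj a) ≫ counitHom adj _ =
      OplaxMonoidal.δ F _ a ≫ counitHom adj (𝟙_ B) ▷ F.obj a ≫ (λ_ (F.obj a)).hom :=
  map_curryHom_counit adj _

lemma tensorUnitHom_spec (a : A) :
    F.map (tensorUnitHom adj a) ≫ counitHom adj _ =
      OplaxMonoidal.δ F a _ ≫ F.obj a ◁ counitHom adj (𝟙_ B) ≫ (ρ_ (F.obj a)).hom :=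
  map_curryHom_counit adj _

lemma tensorUnitHom_eq (a : A) :
    tensorUnitHom adj a = tensorRightAdjoint adj a (𝟙_ B) ≫ R.map (ρ_ (F.obj a)).hom := by
  apply homToRight_ext adj
  rw [F.map_comp, Category.assoc, counitHom_naturality,
    reassoc_of% (tensorRightAdjoint_spec adj), tensorUnitHom_spec]

lemma tensorHomMap_counit (b : B) (a : A) :
    F.map (tensorHomMap adj b a) ≫ counitHom adj (b ⊗ F.obj a) =
      OplaxMonoidal.δ F _ a ≫ counitHom adj b ▷ F.obj a := by
  have h := tensorHomMap_spec adj b a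
  change 𝟙_ B ◁ F.map (tensorHomMap adj b a) ≫ evHom adj (b ⊗ F.obj a) =
    (𝟙_ B ◁ OplaxMonoidal.δ F _ a ≫ (α_ _ _ _).inv) ≫ evHom adj b ▷ F.obj a at h
  simp only [counitHom]
  refine (leftUnitor_inv_naturality_assoc _ _).trans ((congrArg _ h).trans ?_)
  rw [Category.assoc, ← leftUnitor_inv_naturality_assoc, comp_whiskerRight,
    leftUnitor_inv_whiskerRight, Category.assoc]

lemma unitTensorHom_eq (a : A) :
    unitTensorHom adj a = tensorHomMap adj (𝟙_ B) a ≫ R.map (λ_ (F.obj a)).hom := by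
  apply homToRight_ext adj
  rw [F.map_comp, Category.assoc, counitHom_naturality, unitTensorHom_spec]
  have h := congrArg (· ≫ (λ_ (F.obj a)).hom) (tensorHomMap_counit adj (𝟙_ B) a)
  simp only [Category.assoc] at h
  exact h.symm

lemma isIso_tensorUnitHom (hA : IsTensorPr A) (hB : IsTensorPr B)
    (hrigid : IsRigidPr A) (hF : PreservesColimitsOfSize.{v, v} F)
    (hR : PreservesColimitsOfSize.{v, v} R) (a : A) : IsIso (tensorUnitHom adj a) := by
  have := isIso_tensorRightAdjoint_of_isRigidPr adj hA hB hrigid hF hR a (𝟙_ B)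
  rw [tensorUnitHom_eq]
  infer_instance

lemma isIso_unitTensorHom (hA : IsTensorPr A) (hB : IsTensorPr B)
    (hrigid : IsRigidPr A) (hF : PreservesColimitsOfSize.{v, v} F)
    (hR : PreservesColimitsOfSize.{v, v} R) (a : A) : IsIso (unitTensorHom adj a) := by
  have := isIso_tensorHomMap_of_isRigidPr adj hA hrigid hF hR (𝟙_ B) (hB.cocontinuous_left _) a
  rw [unitTensorHom_eq]
  have h : IsIso (R.map (λ_ (F.obj a)).hom) := inferInstance
  exact IsIso.comp_isIso' this h

lemma tensorUnitHom_naturality {a a' : A} (f : a ⟶ a') :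
    f ▷ R.obj (𝟙_ B) ≫ tensorUnitHom adj a' = tensorUnitHom adj a ≫ R.map (F.map f) := by
  rw [tensorUnitHom_eq, tensorUnitHom_eq, reassoc_of% (tensorRightAdjoint_naturality_left adj),
    ← R.map_comp, Category.assoc, ← R.map_comp, rightUnitor_naturality]

lemma unitTensorHom_naturality {a a' : A} (f : a ⟶ a') :
    R.obj (𝟙_ B) ◁ f ≫ unitTensorHom adj a' = unitTensorHom adj a ≫ R.map (F.map f) := by
  apply homToRight_ext adj
  simp only [F.map_comp, Category.assoc]
  rw [unitTensorHom_spec, counitHom_naturality, reassoc_of% (unitTensorHom_spec adj),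
    ← OplaxMonoidal.δ_natural_right_assoc, whisker_exchange_assoc, leftUnitor_naturality]

end FreeRight

/-! ### Monadicity -/

section Beck

variable {C : Type u₁} [Category.{v} C] {D : Type u₂} [Category.{v} D] {L : C ⥤ D} {R : D ⥤ C}

/-- If the right adjoint is conservative and preserves coequalizers, every object is the coequalizer
of its canonical presentation by objects in the image of the left adjoint. -/
lemma isCoequalizer_counit (adj : L ⊣ R) [HasCoequalizers D]
    [PreservesColimitsOfShape WalkingParallelPair R] [R.ReflectsIsomorphisms] (N : D) :
    IsCoequalizer (L.map (R.map (adj.counit.app N))) (adj.counit.app (L.obj (R.obj N)))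
      (adj.counit.app N) := by
  have hw : L.map (R.map (adj.counit.app N)) ≫ adj.counit.app N =
      adj.counit.app (L.obj (R.obj N)) ≫ adj.counit.app N := by simp
  -- the unit of the adjunction splits the image of the fork under `R`
  refine IsCoequalizer.of_map R hw (IsCoequalizer.of_splitting
    { rightSection := adj.unit.app (R.obj N)
      leftSection := adj.unit.app (R.obj (L.obj (R.obj N)))
      condition := by rw [← R.map_comp, hw, R.map_comp] })

end Beck

section ModHelpers

variable {C : Type u₁} [Category.{v} C] [MonoidalCategory C] {S : C} [MonObj S]

/-- An isomorphism of underlying objects that is linear is an isomorphism of modules. -/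
@[simps]
def modIsoMk {X Y : Mod C S} (e : X.X ≅ Y.X) (h : γ[S, X.X] ≫ e.hom = S ◁ e.hom ≫ γ[S, Y.X]) :
    X ≅ Y where
  hom := Mod.Hom.mk' e.hom h
  inv := Mod.Hom.mk' e.inv (by
    change γ[S, Y.X] ≫ e.inv = S ◁ e.inv ≫ γ[S, X.X]
    rw [Iso.comp_inv_eq, Category.assoc, h, ← MonoidalCategory.whiskerLeft_comp_assoc]
    simp)
  hom_inv_id := by ext; exact e.hom_inv_id
  inv_hom_id := by ext; exact e.inv_hom_id

lemma modHom_linear {X Y : Mod C S} (f : X ⟶ Y) : γ[S, X.X] ≫ f.hom = S ◁ f.hom ≫ γ[S, Y.X] :=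
  IsModHom.smul_hom

lemma isIso_modHom_hom {X Y : Mod C S} (f : X ⟶ Y) [IsIso f] : IsIso f.hom :=
  inferInstanceAs (IsIso ((Mod.forget S).map f))

lemma isIso_of_isIso_hom {X Y : Mod C S} (f : X ⟶ Y) (h : IsIso f.hom) : IsIso f := by
  have : f = (modIsoMk (asIso f.hom) (modHom_linear f)).hom := rfl
  rw [this]
  infer_instance

/-- A module is the split coequalizer of its bar construction. -/
lemma isCoequalizer_smul (X : Mod C S) :
    IsCoequalizer (S ◁ γ[S, X.X]) ((α_ S S X.X).inv ≫ μ[S] ▷ X.X) γ[S, X.X] := by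
  have h1 := ModObj.one_smul_self S X.X
  refine IsCoequalizer.of_splitting
    { rightSection := (λ_ X.X).inv ≫ η[S] ▷ X.X
      leftSection := (λ_ (S ⊗ X.X)).inv ≫ η[S] ▷ (S ⊗ X.X)
      condition := by
        rw [Category.assoc, ModObj.mul_smul_self, Iso.inv_hom_id_assoc]
      rightSection_π := by rw [Category.assoc, h1, Iso.inv_hom_id]
      leftSection_bottom := by
        rw [Category.assoc, associator_inv_naturality_left_assoc, ← comp_whiskerRight,
          MonObj.one_mul]
        simp
      leftSection_top := by
        rw [Category.assoc, ← whisker_exchange, leftUnitor_inv_naturality_assoc] }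

end ModHelpers

section Monadicity

variable {C : Type u₁} [Category.{v} C] [MonoidalCategory C]
  {B : Type u₂} [Category.{v} B] [MonoidalCategory B]
  {D : Type u₃} [Category.{v} D] [MonoidalRightAction B D]
  {F : C ⥤ B} [F.Monoidal] {m : D} {R : D ⥤ C} (adj : act F m ⊣ R)

lemma internalComp_map {N N' : D} (f : N ⟶ N') :
    internalComp adj N ≫ R.map f = R.obj m ◁ R.map f ≫ internalComp adj N' :=
  modHom_linear ((toMod adj).map f)

variable [HasCoequalizers D] [PreservesColimitsOfShape WalkingParallelPair R]
  [R.ReflectsIsomorphisms]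

omit [MonoidalCategory C] [F.Monoidal] in
lemma isCoequalizer_evHom (N : D) :
    IsCoequalizer (m ⊴ᵣ F.map (R.map (evHom adj N))) (evHom adj (m ⊙ᵣ F.obj (R.obj N)))
      (evHom adj N) :=
  isCoequalizer_counit adj N

lemma toMod_faithful : (toMod adj).Faithful where
  map_injective {N N'} f g h := by
    have h' : R.map f = R.map g := congrArg Mod.Hom.hom h
    have := (isCoequalizer_evHom adj N).epi
    rw [← cancel_epi (evHom adj N), ← evHom_naturality, ← evHom_naturality, h']

variable (hT : ∀ c : C, IsIso (tensorHomMap adj m c))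

include hT in
lemma toMod_full : (toMod adj).Full where
  map_surjective {N N'} g := by
    obtain ⟨φ, hφ⟩ : ∃ φ : R.obj N ⟶ R.obj N', φ = g.hom := ⟨g.hom, rfl⟩
    have hg : internalComp adj N ≫ φ = R.obj m ◁ φ ≫ internalComp adj N' := by
      rw [hφ]
      exact modHom_linear g
    -- `φ` induces a morphism on the presentation of `N`; the two composites to be compared agree
    -- after the isomorphism `m ◁ (End(m) ⊗ R(N)) ≅ m ◁ R(m ◁ R(N))`, by linearity of `φ`
    obtain ⟨f, hf⟩ := (isCoequalizer_evHom adj N).exists_desc (m ⊴ᵣ F.map φ ≫ evHom adj N') (by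
      rw [← cancel_epi (m ⊴ᵣ F.map (tensorHomMap adj m (R.obj N)))]
      have h1 := tensorHomMap_spec adj m (R.obj N)
      have h2 := internalComp_spec adj N'
      rw [reassoc_of% h1, ← MonoidalRightAction.actionHomRight_comp_assoc, ← F.map_comp,
        ← internalComp_eq, ← map_comp_spec, hg, map_comp_spec, h2,
        reassoc_of% (actAssoc_naturality_right (F := F)),
        MonoidalRightAction.action_exchange_assoc])
    refine ⟨f, ?_⟩
    ext
    rw [← hφ]
    apply internalHom_ext adj
    exact (evHom_naturality adj f).trans hf

omit [R.ReflectsIsomorphisms] in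
include hT in
/-- A module `X` comes from the coequalizer of `m ◁ (End(m) ⊗ X) ⇉ m ◁ X`: by the projection
formula, `R` sends this pair to the bar construction of `X`. -/
lemma toMod_essSurj : (toMod adj).EssSurj where
  mem_essImage X := by
    let x : R.obj m ⊗ X.X ⟶ X.X := γ[(endAlg adj).X, X.X]
    let f : m ⊙ᵣ F.obj (R.obj m ⊗ X.X) ⟶ m ⊙ᵣ F.obj X.X := m ⊴ᵣ F.map x
    let g : m ⊙ᵣ F.obj (R.obj m ⊗ X.X) ⟶ m ⊙ᵣ F.obj X.X :=
      actAssoc F m (R.obj m) X.X ≫ evHom adj m ⊵ᵣ F.obj X.X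
    let q := coequalizer.π f g
    have hq := (IsCoequalizer.ofHasCoequalizer (f := f) (g := g)).map R
    have hx : IsCoequalizer (R.obj m ◁ x) ((α_ _ _ _).inv ≫ internalComp adj m ▷ X.X) x :=
      isCoequalizer_smul X
    have hxe := hx.epi
    obtain ⟨z, hz⟩ := hq.exists_iso_of_comm hx (tensorHomMap adj m (R.obj m ⊗ X.X)) inferInstance
      (tensorHomMap adj m X.X) inferInstance (tensorHomMap_naturality_right adj m x) (by
        rw [R.map_comp, reassoc_of% (tensorHomMap_assoc adj m), ← tensorHomMap_naturality_left,
          internalComp_eq, comp_whiskerRight, Category.assoc, Category.assoc])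
    have hz' : x ≫ z.hom = tensorHomMap adj m X.X ≫ R.map q := hz
    refine ⟨_, ⟨(modIsoMk (Y := (toMod adj).obj (coequalizer f g)) z ?_).symm⟩⟩
    change x ≫ z.hom = R.obj m ◁ z.hom ≫ internalComp adj _
    -- linearity of `z` may be checked after precomposition with the split epimorphism `x`
    have hx2 : Epi (R.obj m ◁ x) := by
      have hs : ((λ_ X.X).inv ≫ internalId adj ▷ X.X) ≫ x = 𝟙 _ := by
        rw [Category.assoc, Iso.inv_comp_eq, Category.comp_id]
        exact ModObj.one_smul_self (endAlg adj).X X.X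
      have : IsSplitEpi x := ⟨⟨_, hs⟩⟩
      exact inferInstanceAs (Epi ((tensorLeft (R.obj m)).map x))
    rw [← cancel_epi (R.obj m ◁ x), ← MonoidalCategory.whiskerLeft_comp_assoc, hz',
      MonoidalCategory.whiskerLeft_comp, Category.assoc, ← internalComp_map, ← hz,
      reassoc_of% hx.w]
    have h := tensorHomMap_linear adj m X.X
    rw [← Iso.inv_comp_eq] at h
    rw [← reassoc_of% h, ← hz']

include hT in
/-- Monadicity: `D` is the category of `End(m)`-modules as soon as `Hom(m, -)` is conservative,
preserves coequalizers and satisfies the projection formula at `m`. -/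
lemma toMod_isEquivalence : (toMod adj).IsEquivalence where
  faithful := toMod_faithful adj
  full := toMod_full adj hT
  essSurj := toMod_essSurj adj hT

end Monadicity

/-! ### Relative tensor products -/

lemma IsCoequalizer.symm {C : Type u₁} [Category.{v} C] {X Y Z : C} {f g : X ⟶ Y} {q : Y ⟶ Z}
    (h : IsCoequalizer f g q) : IsCoequalizer g f q :=
  IsCoequalizer.of_exists_desc h.epi h.w.symm fun k hk => h.exists_desc k hk.symm

section FreeAdjunction

variable {A : Type u₁} [Category.{v} A]
  {B : Type u₂} [Category.{v} B] [MonoidalCategory B]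
  {F : A ⥤ B} {R : B ⥤ A} (adj : act F (𝟙_ B) ⊣ R)

/-- The adjunction `F ⊣ R` obtained from `𝟙 ⊗ F(-) ⊣ R`. -/
def freeAdjunction : F ⊣ R :=
  Adjunction.mkOfHomEquiv
    { homEquiv a b :=
        { toFun g := curryHom adj ((λ_ _).hom ≫ g)
          invFun f := F.map f ≫ counitHom adj b
          left_inv g := map_curryHom_counit adj g
          right_inv f := homToRight_ext adj (map_curryHom_counit adj _) }
      homEquiv_naturality_left_symm f g := by simp
      homEquiv_naturality_right f g := by
        apply homToRight_ext adj
        rw [F.map_comp, Category.assoc, counitHom_naturality]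
        change F.map (curryHom adj _) ≫ _ = F.map (curryHom adj _) ≫ _ ≫ _
        rw [map_curryHom_counit, reassoc_of% (map_curryHom_counit adj)] }

lemma freeAdjunction_counit_app (b : B) : (freeAdjunction adj).counit.app b = counitHom adj b := by
  simp [freeAdjunction]

lemma isCoequalizer_counitHom [HasCoequalizers B] [PreservesColimitsOfShape WalkingParallelPair R]
    [R.ReflectsIsomorphisms] (b : B) :
    IsCoequalizer (F.map (R.map (counitHom adj b))) (counitHom adj (F.obj (R.obj b)))
      (counitHom adj b) := by
  simpa only [freeAdjunction_counit_app] using isCoequalizer_counit (freeAdjunction adj) b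

lemma evHom_eq_counitHom (b : B) : evHom adj b = (λ_ _).hom ≫ counitHom adj b := by
  simp [counitHom]

end FreeAdjunction

section ActOnHom

variable {A : Type u₁} [Category.{v} A]
  {B : Type u₂} [Category.{v} B] [MonoidalCategory B] {F : A ⥤ B}
  {M : Type u₃} [Category.{v} M] [MonoidalRightAction B M]
  {R : B ⥤ A} (adj : act F (𝟙_ B) ⊣ R) {m : M} {RA : M ⥤ A} (adjA : act F m ⊣ RA)

/-- The canonical morphism `Hom_A(𝟙, b) ⟶ Hom_A(m, m ⊙ᵣ b)`. -/
def actOnHom (b : B) : R.obj b ⟶ RA.obj (m ⊙ᵣ b) := curryHom adjA (m ⊴ᵣ counitHom adj b)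

lemma actOnHom_spec (b : B) :
    m ⊴ᵣ F.map (actOnHom adj adjA b) ≫ evHom adjA _ = m ⊴ᵣ counitHom adj b :=
  curryHom_spec adjA _

lemma actOnHom_naturality {b c : B} (g : b ⟶ c) :
    R.map g ≫ actOnHom adj adjA c = actOnHom adj adjA b ≫ RA.map (m ⊴ᵣ g) := by
  apply internalHom_ext adjA
  rw [map_comp_spec, map_comp_map_spec, actOnHom_spec, actOnHom_spec,
    ← MonoidalRightAction.actionHomRight_comp, counitHom_naturality,
    MonoidalRightAction.actionHomRight_comp]

end ActOnHom

section RelMap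

variable {A : Type u₁} [Category.{v} A] [MonoidalCategory A]
  {B : Type u₂} [Category.{v} B] [MonoidalCategory B] {F : A ⥤ B} [F.Monoidal]
  {M : Type u₃} [Category.{v} M] [MonoidalRightAction B M]
  {R : B ⥤ A} (adj : act F (𝟙_ B) ⊣ R) {m : M} {RA : M ⥤ A} (adjA : act F m ⊣ RA)

lemma internalId_counit : F.map (internalId adj) ≫ counitHom adj (𝟙_ B) = OplaxMonoidal.η F := by
  have h := internalId_spec adj
  change 𝟙_ B ◁ F.map (internalId adj) ≫ evHom adj _ = 𝟙_ B ◁ OplaxMonoidal.η F ≫ (ρ_ _).hom at h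
  rw [counitHom, leftUnitor_inv_naturality_assoc, h]
  rw [← leftUnitor_inv_naturality_assoc, ← unitors_equal, Iso.inv_hom_id, Category.comp_id]

lemma internalComp_eq_unitTensorHom (b : B) :
    internalComp adj b = unitTensorHom adj (R.obj b) ≫ R.map (counitHom adj b) := by
  rw [unitTensorHom_eq, Category.assoc, ← R.map_comp, ← evHom_eq_counitHom]
  exact internalComp_eq adj b

lemma internalComp_counit (b : B) :
    F.map (internalComp adj b) ≫ counitHom adj b =
      OplaxMonoidal.δ F _ _ ≫ (counitHom adj (𝟙_ B) ⊗ₘ counitHom adj b) ≫ (λ_ b).hom := by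
  rw [internalComp_eq_unitTensorHom, F.map_comp, Category.assoc, counitHom_naturality,
    reassoc_of% (unitTensorHom_spec adj), MonoidalCategory.tensorHom_def, Category.assoc,
    leftUnitor_naturality]

/-- The morphism `ρ`, with `End_A(𝟙)` and `End_A(m)` written as `R(𝟙)` and `RA(m)`. -/
def rhoMap : R.obj (𝟙_ B) ⟶ RA.obj m := rhoHom adj adjA

lemma rhoMap_spec :
    m ⊴ᵣ F.map (rhoMap adj adjA) ≫ evHom adjA m = m ⊴ᵣ counitHom adj (𝟙_ B) ≫ (ρᵣ m).hom :=
  curryHom_spec adjA _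

lemma rhoMap_eq : rhoMap adj adjA = actOnHom adj adjA (𝟙_ B) ≫ RA.map (ρᵣ m).hom := by
  apply internalHom_ext adjA
  rw [rhoMap_spec, map_comp_map_spec, actOnHom_spec]

/-- `R(b) ⟶ Hom_A(m, m ⊙ᵣ b)` is linear along `ρ`. -/
lemma actOnHom_linear (b : B) :
    internalComp adj b ≫ actOnHom adj adjA b =
      rhoMap adj adjA ▷ R.obj b ≫ RA.obj m ◁ actOnHom adj adjA b ≫ internalComp adjA (m ⊙ᵣ b) := by
  apply internalHom_ext adjA
  rw [map_comp_spec, actOnHom_spec, ← MonoidalRightAction.actionHomRight_comp,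
    internalComp_counit, map_comp_spec, map_comp_spec, internalComp_spec,
    reassoc_of% (actAssoc_naturality_right (F := F)), MonoidalRightAction.action_exchange_assoc,
    actOnHom_spec, reassoc_of% (actAssoc_naturality_left (F := F)),
    ← MonoidalRightAction.comp_actionHomLeft_assoc, rhoMap_spec]
  simp [actAssoc, MonoidalCategory.tensorHom_def, -LaxMonoidal.left_unitality]

lemma isMonHom_rhoHom : IsMonHom (rhoHom adj adjA) where
  one_hom := by
    change internalId adj ≫ rhoMap adj adjA = internalId adjA
    apply internalHom_ext adjA
    rw [map_comp_spec, rhoMap_spec, internalId_spec, actUnit,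
      ← MonoidalRightAction.actionHomRight_comp_assoc, internalId_counit]
  mul_hom := by
    change internalComp adj (𝟙_ B) ≫ rhoMap adj adjA =
      (rhoMap adj adjA ⊗ₘ rhoMap adj adjA) ≫ internalComp adjA m
    rw [rhoMap_eq, reassoc_of% (actOnHom_linear adj adjA), internalComp_map, ← rhoMap_eq,
      MonoidalCategory.tensorHom_def, Category.assoc, rhoMap_eq,
      MonoidalCategory.whiskerLeft_comp, Category.assoc]

lemma relMap_spec (N : M) (b : B) :
    m ⊴ᵣ F.map (relMap adj adjA N b) ≫ evHom adjA (N ⊙ᵣ b) =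
      actAssoc F m (RA.obj N) (R.obj b) ≫ evHom adjA N ⊵ᵣ F.obj (R.obj b) ≫
        N ⊴ᵣ counitHom adj b :=
  curryHom_spec adjA _

lemma relMap_eq (N : M) (b : B) :
    relMap adj adjA N b = tensorHomMap adjA N (R.obj b) ≫ RA.map (N ⊴ᵣ counitHom adj b) := by
  apply internalHom_ext adjA
  rw [relMap_spec, map_comp_map_spec, tensorHomMap_spec, Category.assoc]

lemma relMap_naturality_left {N N' : M} (f : N ⟶ N') (b : B) :
    RA.map f ▷ R.obj b ≫ relMap adj adjA N' b = relMap adj adjA N b ≫ RA.map (f ⊵ᵣ b) := by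
  rw [relMap_eq, relMap_eq, reassoc_of% (tensorHomMap_naturality_left adjA), Category.assoc,
    ← RA.map_comp, ← RA.map_comp, MonoidalRightAction.action_exchange]

lemma relMap_naturality_right (N : M) {b c : B} (g : b ⟶ c) :
    RA.obj N ◁ R.map g ≫ relMap adj adjA N c = relMap adj adjA N b ≫ RA.map (N ⊴ᵣ g) := by
  rw [relMap_eq, relMap_eq, reassoc_of% (tensorHomMap_naturality_right adjA), Category.assoc,
    ← RA.map_comp, ← RA.map_comp, ← MonoidalRightAction.actionHomRight_comp,
    ← MonoidalRightAction.actionHomRight_comp, counitHom_naturality]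

lemma relMap_linear (N : M) (b : B) :
    internalComp adjA N ▷ R.obj b ≫ relMap adj adjA N b =
      (α_ (RA.obj m) (RA.obj N) (R.obj b)).hom ≫ RA.obj m ◁ relMap adj adjA N b ≫
        internalComp adjA (N ⊙ᵣ b) := by
  rw [relMap_eq, reassoc_of% (tensorHomMap_linear adjA), internalComp_map,
    MonoidalCategory.whiskerLeft_comp, Category.assoc]

/-- The right action of `E = R(𝟙)` on `Hom_A(m, N)` induced by `N ⊙ᵣ 𝟙 ≅ N`. -/
def unitAction (N : M) : RA.obj N ⊗ R.obj (𝟙_ B) ⟶ RA.obj N :=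
  relMap adj adjA N (𝟙_ B) ≫ RA.map (ρᵣ N).hom

lemma unitAction_spec (N : M) :
    m ⊴ᵣ F.map (unitAction adj adjA N) ≫ evHom adjA N =
      actAssoc F m (RA.obj N) (R.obj (𝟙_ B)) ≫ evHom adjA N ⊵ᵣ F.obj (R.obj (𝟙_ B)) ≫
        N ⊴ᵣ counitHom adj (𝟙_ B) ≫ (ρᵣ N).hom := by
  rw [unitAction, map_comp_map_spec, relMap_spec, Category.assoc, Category.assoc]

/-- On `b = F(a)`, where `R(F(a)) ≅ E ⊗ a`, the relative tensor map contracts `E`. -/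
lemma relMap_free (N : M) (a : A) :
    RA.obj N ◁ unitTensorHom adj a ≫ relMap adj adjA N (F.obj a) =
      (α_ (RA.obj N) (R.obj (𝟙_ B)) a).inv ≫ unitAction adj adjA N ▷ a ≫
        tensorHomMap adjA N a := by
  rw [← cancel_epi (α_ (RA.obj N) (R.obj (𝟙_ B)) a).hom, Iso.hom_inv_id_assoc]
  apply internalHom_ext adjA
  rw [map_comp_spec, map_comp_spec, relMap_spec, map_comp_spec, tensorHomMap_spec,
    reassoc_of% (actAssoc_naturality_left (F := F)), ← MonoidalRightAction.comp_actionHomLeft,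
    unitAction_spec, reassoc_of% (actAssoc_naturality_right (F := F)),
    MonoidalRightAction.action_exchange_assoc, ← MonoidalRightAction.actionHomRight_comp,
    unitTensorHom_spec]
  simp only [MonoidalRightAction.comp_actionHomLeft]
  rw [← reassoc_of% (actAssoc_assoc F m), ← reassoc_of% (actAssoc_naturality_obj F)]
  simp [actAssoc, -LaxMonoidal.left_unitality]

/-- Together with `unitTensorHom_comp`: the right action of `E` on `Hom_A(m, N)` is the left action
by restriction along `ρ`, transported through `a ⊗ E ≅ R(F(a)) ≅ E ⊗ a`, as both factor through the
same morphism out of `R(F(a))`. -/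
lemma tensorUnitHom_comp (N : M) :
    tensorUnitHom adj (RA.obj N) ≫ actOnHom adj adjA (F.obj (RA.obj N)) ≫
      RA.map (evHom adjA N) = unitAction adj adjA N := by
  apply internalHom_ext adjA
  rw [unitAction_spec, map_comp_spec, map_comp_map_spec, actOnHom_spec,
    ← MonoidalRightAction.actionHomRight_comp_assoc, tensorUnitHom_spec,
    ← MonoidalRightAction.action_exchange_assoc,
    ← MonoidalRightAction.actionUnitIso_hom_naturality]
  simp [actAssoc, -LaxMonoidal.right_unitality]

lemma unitTensorHom_comp (N : M) :
    unitTensorHom adj (RA.obj N) ≫ actOnHom adj adjA (F.obj (RA.obj N)) ≫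
      RA.map (evHom adjA N) = rhoMap adj adjA ▷ RA.obj N ≫ internalComp adjA N := by
  apply internalHom_ext adjA
  rw [map_comp_spec, map_comp_map_spec, actOnHom_spec, map_comp_spec, internalComp_spec,
    ← MonoidalRightAction.actionHomRight_comp_assoc, unitTensorHom_spec,
    reassoc_of% (actAssoc_naturality_left (F := F)),
    ← MonoidalRightAction.comp_actionHomLeft_assoc, rhoMap_spec]
  simp [actAssoc, -LaxMonoidal.left_unitality]

/-- `Hom_A(m, N ⊙ᵣ b)` is the relative tensor product of `Hom_A(m, N)` and `R(b)` over `E`: apply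
`Hom_A(m, N ⊙ᵣ -)` to the canonical presentation of `b` by objects in the image of `F`, and use the
projection formula. -/
lemma isCoequalizer_relMap [HasCoequalizers B] [PreservesColimitsOfShape WalkingParallelPair R]
    [R.ReflectsIsomorphisms] [PreservesColimitsOfShape WalkingParallelPair RA] (N : M)
    [PreservesColimitsOfShape WalkingParallelPair (MonoidalRightAction.actionLeft (C := B) N)]
    (hT : ∀ a : A, IsIso (tensorHomMap adjA N a)) (hE : ∀ a : A, IsIso (unitTensorHom adj a))
    (b : B) :
    IsCoequalizer (unitAction adj adjA N ▷ R.obj b)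
      ((α_ (RA.obj N) (R.obj (𝟙_ B)) (R.obj b)).hom ≫ RA.obj N ◁ internalComp adj b)
      (relMap adj adjA N b) := by
  have h : IsCoequalizer (RA.map (N ⊴ᵣ F.map (R.map (counitHom adj b))))
      (RA.map (N ⊴ᵣ counitHom adj (F.obj (R.obj b)))) (RA.map (N ⊴ᵣ counitHom adj b)) :=
    ((isCoequalizer_counitHom adj b).map (MonoidalRightAction.actionLeft (C := B) N)).map RA
  refine h.symm.of_iso ((α_ _ _ _).hom ≫ RA.obj N ◁ unitTensorHom adj (R.obj b) ≫
    tensorHomMap adjA N (R.obj (F.obj (R.obj b)))) inferInstance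
    (tensorHomMap adjA N (R.obj b)) inferInstance (𝟙 _) inferInstance ?_ ?_ ?_
  · rw [Category.assoc, Category.assoc, ← relMap_eq, relMap_free, Iso.hom_inv_id_assoc]
  · rw [internalComp_eq_unitTensorHom, MonoidalCategory.whiskerLeft_comp]
    simp only [Category.assoc]
    rw [tensorHomMap_naturality_right]
  · rw [Category.comp_id, relMap_eq]

end RelMap

/-! ### Internal homs for the action of `B` -/

section Existence

variable {A : Type u₁} [Category.{v} A] [MonoidalCategory A]
  {B : Type u₂} [Category.{v} B] [MonoidalCategory B] {F : A ⥤ B} [F.Monoidal]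
  {M : Type u₃} [Category.{v} M] [MonoidalRightAction B M]
  {R : B ⥤ A} (adj : act F (𝟙_ B) ⊣ R) {m : M} {RA : M ⥤ A} (adjA : act F m ⊣ RA)

/-- The object `Hom_A(m, N)` as an `E`-module, by restriction along `ρ`. -/
def restrictedHom (N : M) : Mod A (endAlg adj).X :=
  letI := isMonHom_rhoHom adj adjA
  (Mod.comap (rhoHom adj adjA)).obj ((toMod adjA).obj N)

/-- A morphism `m ⊙ᵣ b ⟶ N` induces an `E`-linear morphism `R(b) ⟶ Hom_A(m, N)`. -/
def toRestrictedHom (b : B) (N : M) (f : m ⊙ᵣ b ⟶ N) :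
    (toMod adj).obj b ⟶ restrictedHom adj adjA N :=
  Mod.Hom.mk' (actOnHom adj adjA b ≫ RA.map f) (by
    change internalComp adj b ≫ actOnHom adj adjA b ≫ RA.map f =
      R.obj (𝟙_ B) ◁ (actOnHom adj adjA b ≫ RA.map f) ≫ rhoMap adj adjA ▷ RA.obj N ≫
        internalComp adjA N
    rw [reassoc_of% (actOnHom_linear adj adjA), internalComp_map, whisker_exchange_assoc,
      MonoidalCategory.whiskerLeft_comp, Category.assoc])

omit [MonoidalCategory A] [F.Monoidal] in
lemma actOnHom_map {b b' : B} {N : M} (f : b ⟶ b') (g : m ⊙ᵣ b' ⟶ N) :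
    actOnHom adj adjA b ≫ RA.map (m ⊴ᵣ f ≫ g) =
      R.map f ≫ actOnHom adj adjA b' ≫ RA.map g := by
  rw [RA.map_comp, reassoc_of% (actOnHom_naturality adj adjA)]

variable [HasCoequalizers B] [PreservesColimitsOfShape WalkingParallelPair R]
  [R.ReflectsIsomorphisms]
  [PreservesColimitsOfShape WalkingParallelPair (MonoidalRightAction.actionLeft (C := B) m)]

omit [MonoidalCategory A] [F.Monoidal] in
lemma isCoequalizer_actionHomRight_counitHom (b : B) :
    IsCoequalizer (m ⊴ᵣ F.map (R.map (counitHom adj b))) (m ⊴ᵣ counitHom adj (F.obj (R.obj b)))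
      (m ⊴ᵣ counitHom adj b) :=
  (isCoequalizer_counitHom adj b).map (MonoidalRightAction.actionLeft (C := B) m)

/-- Morphisms `m ⊙ᵣ b ⟶ N` are `E`-linear morphisms `R(b) ⟶ Hom_A(m, N)`: present `b` by objects in
the image of `F`. -/
lemma toRestrictedHom_bijective (hE : ∀ a : A, IsIso (unitTensorHom adj a)) (b : B) (N : M) :
    Function.Bijective (toRestrictedHom adj adjA b N) := by
  have hc := isCoequalizer_actionHomRight_counitHom (m := m) adj b
  have hepi := hc.epi
  refine ⟨fun f f' h => ?_, fun g => ?_⟩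
  · have h' : actOnHom adj adjA b ≫ RA.map f = actOnHom adj adjA b ≫ RA.map f' :=
      congrArg Mod.Hom.hom h
    have h2 := congrArg (fun t => m ⊴ᵣ F.map t ≫ evHom adjA N) h'
    rw [map_comp_map_spec, map_comp_map_spec, actOnHom_spec] at h2
    exact (cancel_epi _).1 h2
  · obtain ⟨φ, hφ⟩ : ∃ φ : R.obj b ⟶ RA.obj N, φ = g.hom := ⟨g.hom, rfl⟩
    have hg : internalComp adj b ≫ φ =
        R.obj (𝟙_ B) ◁ φ ≫ rhoMap adj adjA ▷ RA.obj N ≫ internalComp adjA N := by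
      rw [hφ]
      exact modHom_linear g
    obtain ⟨f, hf⟩ := hc.exists_desc (m ⊴ᵣ F.map φ ≫ evHom adjA N) (by
      rw [← cancel_epi (m ⊴ᵣ F.map (unitTensorHom adj (R.obj b))),
        ← MonoidalRightAction.actionHomRight_comp_assoc, ← F.map_comp,
        ← internalComp_eq_unitTensorHom, ← map_comp_spec, hg, ← unitTensorHom_comp,
        reassoc_of% (unitTensorHom_naturality adj), map_comp_spec, map_comp_spec,
        map_comp_map_spec, actOnHom_spec, ← MonoidalRightAction.actionHomRight_comp_assoc,
        ← MonoidalRightAction.actionHomRight_comp_assoc, Category.assoc, counitHom_naturality,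
        MonoidalRightAction.actionHomRight_comp_assoc,
        MonoidalRightAction.actionHomRight_comp_assoc])
    refine ⟨f, ?_⟩
    ext
    rw [← hφ]
    apply internalHom_ext adjA
    change m ⊴ᵣ F.map (actOnHom adj adjA b ≫ RA.map f) ≫ evHom adjA N = _
    rw [map_comp_map_spec, actOnHom_spec, hf]
    rfl

include adjA in
/-- The action of `B` on `m` has a right adjoint as soon as `B` is the category of `E`-modules. -/
lemma exists_act_adjunction (hT : ∀ a : A, IsIso (tensorHomMap adj (𝟙_ B) a))
    (hE : ∀ a : A, IsIso (unitTensorHom adj a)) :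
    ∃ RB : M ⥤ B, Nonempty (act (𝟭 B) m ⊣ RB) := by
  have := toMod_isEquivalence adj hT
  -- `Hom_B(m, N)` is the object of `B` corresponding to the `E`-module `Hom_A(m, N)`
  let e (b : B) (N : M) :
      ((act (𝟭 B) m).obj b ⟶ N) ≃ (b ⟶ (toMod adj).objPreimage (restrictedHom adj adjA N)) :=
    (Equiv.ofBijective _ (toRestrictedHom_bijective adj adjA hE b N)).trans
      ((((toMod adj).objObjPreimageIso (restrictedHom adj adjA N)).symm.homToEquiv).trans
        (Functor.FullyFaithful.ofFullyFaithful (toMod adj)).homEquiv.symm)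
  refine ⟨_, ⟨Adjunction.adjunctionOfEquivRight e ?_⟩⟩
  intro b b' N f g
  apply (toMod adj).map_injective
  have he (b : B) (N : M) (g : (act (𝟭 B) m).obj b ⟶ N) : (toMod adj).map (e b N g) =
      toRestrictedHom adj adjA b N g ≫
        ((toMod adj).objObjPreimageIso (restrictedHom adj adjA N)).inv :=
    (Functor.FullyFaithful.ofFullyFaithful (toMod adj)).homEquiv.apply_symm_apply _
  rw [Functor.map_comp, he, he, ← Category.assoc]
  congr 1
  ext
  exact actOnHom_map adj adjA f g

end Existence

/-! ### Comparison of the internal homs for `A` and `B` -/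

section Compare

variable {A : Type u₁} [Category.{v} A]
  {B : Type u₂} [Category.{v} B] [MonoidalCategory B] {F : A ⥤ B}
  {M : Type u₃} [Category.{v} M] [MonoidalRightAction B M]
  {R : B ⥤ A} (adj : act F (𝟙_ B) ⊣ R) {m : M} {RA : M ⥤ A} (adjA : act F m ⊣ RA)
  {RB : M ⥤ B} (adjB : act (𝟭 B) m ⊣ RB)

/-- The evaluation `m ⊙ᵣ Hom_B(m, N) ⟶ N`. -/
def evB (N : M) : m ⊙ᵣ RB.obj N ⟶ N := evHom adjB N

lemma evB_naturality {N N' : M} (f : N ⟶ N') :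
    m ⊴ᵣ RB.map f ≫ evB adjB N' = evB adjB N ≫ f :=
  evHom_naturality adjB f

lemma homB_ext {c : B} {N : M} {f g : c ⟶ RB.obj N}
    (h : m ⊴ᵣ f ≫ evB adjB N = m ⊴ᵣ g ≫ evB adjB N) : f = g :=
  internalHom_ext adjB h

/-- The canonical morphism `R(Hom_B(m, N)) ⟶ Hom_A(m, N)`. -/
def compareMap (N : M) : R.obj (RB.obj N) ⟶ RA.obj N :=
  curryHom adjA (m ⊴ᵣ counitHom adj (RB.obj N) ≫ evB adjB N)

lemma compareMap_spec (N : M) :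
    m ⊴ᵣ F.map (compareMap adj adjA adjB N) ≫ evHom adjA N =
      m ⊴ᵣ counitHom adj (RB.obj N) ≫ evB adjB N :=
  curryHom_spec adjA _

lemma compareMap_naturality {N N' : M} (f : N ⟶ N') :
    R.map (RB.map f) ≫ compareMap adj adjA adjB N' = compareMap adj adjA adjB N ≫ RA.map f := by
  apply internalHom_ext adjA
  rw [map_comp_spec, map_comp_map_spec, compareMap_spec, compareMap_spec, Category.assoc,
    ← MonoidalRightAction.actionHomRight_comp_assoc, counitHom_naturality,
    MonoidalRightAction.actionHomRight_comp_assoc, evB_naturality]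

/-- The action of `A` on `m` factors through that of `B`, hence so does its right adjoint. -/
def compareIso : RB ⋙ R ≅ RA :=
  let adj' : act F m ⊣ RB ⋙ R := (freeAdjunction adj).comp adjB
  adj'.rightAdjointUniq adjA

lemma compareIso_hom_app (N : M) :
    (compareIso adj adjA adjB).hom.app N = compareMap adj adjA adjB N := by
  let adj' : act F m ⊣ RB ⋙ R := (freeAdjunction adj).comp adjB
  apply internalHom_ext adjA
  rw [compareMap_spec]
  have h := adj'.rightAdjointUniq_hom_app_counit adjA N
  refine h.trans ?_
  have h2 := Adjunction.comp_counit_app (freeAdjunction adj) adjB N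
  rw [freeAdjunction_counit_app] at h2
  exact h2

instance (N : M) : IsIso (compareMap adj adjA adjB N) := by
  rw [← compareIso_hom_app]
  infer_instance

include adj adjA adjB in
lemma reflectsIsomorphisms_homB [RA.ReflectsIsomorphisms] : RB.ReflectsIsomorphisms :=
  have : (RB ⋙ R).ReflectsIsomorphisms :=
    reflectsIsomorphisms_of_iso (compareIso adj adjA adjB).symm
  reflectsIsomorphisms_of_comp RB R

include adj adjA adjB in
lemma cocontinuous_homB (hB : HasColimitsOfSize.{v, v} B) [R.ReflectsIsomorphisms]
    (hR : PreservesColimitsOfSize.{v, v} R) (hRA : PreservesColimitsOfSize.{v, v} RA) :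
    PreservesColimitsOfSize.{v, v} RB :=
  have : PreservesColimitsOfSize.{v, v} (RB ⋙ R) :=
    preservesColimits_of_natIso (compareIso adj adjA adjB).symm
  have : ReflectsColimitsOfSize.{v, v} R := reflectsColimits_of_reflectsIsomorphisms
  preservesColimits_of_reflects_of_preserves RB R

end Compare

section CompareMonoidal

variable {A : Type u₁} [Category.{v} A] [MonoidalCategory A]
  {B : Type u₂} [Category.{v} B] [MonoidalCategory B] {F : A ⥤ B} [F.Monoidal]
  {M : Type u₃} [Category.{v} M] [MonoidalRightAction B M]
  {R : B ⥤ A} (adj : act F (𝟙_ B) ⊣ R) {m : M} {RA : M ⥤ A} (adjA : act F m ⊣ RA)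
  {RB : M ⥤ B} (adjB : act (𝟭 B) m ⊣ RB)

/-- The canonical morphism `Hom_B(m, N) ⊗ b ⟶ Hom_B(m, N ⊙ᵣ b)`. -/
def tensorHomB (N : M) (b : B) : RB.obj N ⊗ b ⟶ RB.obj (N ⊙ᵣ b) := tensorHomMap adjB N b

lemma tensorHomB_spec (N : M) (b : B) :
    m ⊴ᵣ tensorHomB adjB N b ≫ evB adjB (N ⊙ᵣ b) =
      (αᵣ m (RB.obj N) b).hom ≫ evB adjB N ⊵ᵣ b := by
  have h := tensorHomMap_spec adjB N b
  refine h.trans ?_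
  simp [actAssoc]
  rfl

lemma actAssoc_id (N : M) (b c : B) : actAssoc (𝟭 B) N b c = (αᵣ N b c).hom := by
  simp [actAssoc]

lemma actUnit_id (N : M) : actUnit (𝟭 B) N = (ρᵣ N).hom := by
  simp [actUnit]

lemma tensorHomB_assoc (N : M) (b c : B) :
    tensorHomB adjB N (b ⊗ c) ≫ RB.map (αᵣ N b c).hom =
      (α_ (RB.obj N) b c).inv ≫ tensorHomB adjB N b ▷ c ≫ tensorHomB adjB (N ⊙ᵣ b) c := by
  rw [← actAssoc_id]
  exact tensorHomMap_assoc adjB N b c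

lemma tensorHomB_unit (N : M) :
    tensorHomB adjB N (𝟙_ B) ≫ RB.map (ρᵣ N).hom = (ρ_ (RB.obj N)).hom := by
  rw [← actUnit_id]
  exact tensorHomMap_unit adjB N

/-- For `B` acting on itself, `relMap` is the lax monoidal structure of `R`. -/
lemma relMap_self_counit (X b : B) :
    F.map (relMap adj adj X b) ≫ counitHom adj (X ⊗ b) =
      OplaxMonoidal.δ F _ _ ≫ (counitHom adj X ⊗ₘ counitHom adj b) := by
  have h := tensorHomMap_counit adj X (R.obj b)
  have h2 := counitHom_naturality adj (X ◁ counitHom adj b)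
  rw [relMap_eq, F.map_comp, Category.assoc]
  refine (congrArg _ h2).trans ?_
  rw [← Category.assoc]
  refine (congrArg (· ≫ _) h).trans ?_
  rw [MonoidalCategory.tensorHom_def, Category.assoc]

/-- The morphisms `R(Hom_B(m, N)) ⟶ Hom_A(m, N)` are compatible with the actions of `B`. -/
lemma compareMap_relMap (N : M) (b : B) :
    compareMap adj adjA adjB N ▷ R.obj b ≫ relMap adj adjA N b =
      relMap adj adj (RB.obj N) b ≫ R.map (tensorHomB adjB N b) ≫
        compareMap adj adjA adjB (N ⊙ᵣ b) := by
  apply internalHom_ext adjA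
  rw [map_comp_spec, relMap_spec, map_comp_spec, map_comp_spec, compareMap_spec,
    ← MonoidalRightAction.actionHomRight_comp_assoc m (F.map (R.map _)), counitHom_naturality,
    MonoidalRightAction.actionHomRight_comp_assoc, tensorHomB_spec,
    ← MonoidalRightAction.actionHomRight_comp_assoc]
  erw [relMap_self_counit]
  rw [reassoc_of% (actAssoc_naturality_left (F := F)),
    ← MonoidalRightAction.comp_actionHomLeft_assoc, compareMap_spec]
  simp only [actAssoc, MonoidalCategory.tensorHom_def, MonoidalRightAction.actionHomRight_comp,
    MonoidalRightAction.comp_actionHomLeft, Category.assoc,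
    ← MonoidalRightAction.action_exchange]
  simp

lemma compareMap_unitAction (N : M) :
    unitAction adj adj (RB.obj N) ≫ compareMap adj adjA adjB N =
      compareMap adj adjA adjB N ▷ R.obj (𝟙_ B) ≫ unitAction adj adjA N := by
  rw [unitAction, unitAction, reassoc_of% (compareMap_relMap adj adjA adjB),
    ← compareMap_naturality, ← R.map_comp_assoc, tensorHomB_unit, Category.assoc]
  rfl

/-- The projection formula for the action of `B`: both sides become, under `R`, the relative tensor
product of `Hom_A(m, N)` and `R(b)` over `E`. -/
lemma isIso_tensorHomB [R.ReflectsIsomorphisms] (N : M) (b : B)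
    (h : IsCoequalizer (unitAction adj adjA N ▷ R.obj b)
      ((α_ (RA.obj N) (R.obj (𝟙_ B)) (R.obj b)).hom ≫ RA.obj N ◁ internalComp adj b)
      (relMap adj adjA N b))
    (h' : IsCoequalizer (unitAction adj adj (RB.obj N) ▷ R.obj b)
      ((α_ (R.obj (RB.obj N)) (R.obj (𝟙_ B)) (R.obj b)).hom ≫
        R.obj (RB.obj N) ◁ internalComp adj b)
      (relMap adj adj (RB.obj N) b)) :
    IsIso (tensorHomB adjB N b) := by
  have h1 : IsIso (R.map (tensorHomB adjB N b) ≫ compareMap adj adjA adjB (N ⊙ᵣ b)) := by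
    refine h.isIso_of_comm h'
      ((compareMap adj adjA adjB N ▷ R.obj (𝟙_ B)) ▷ R.obj b) inferInstance
      (compareMap adj adjA adjB N ▷ R.obj b) inferInstance _ ?_ ?_ ?_
    · rw [← comp_whiskerRight, ← comp_whiskerRight, compareMap_unitAction]
    · rw [Category.assoc, whisker_exchange]
      simp
    · rw [compareMap_relMap]
  have h2 : IsIso (R.map (tensorHomB adjB N b)) := IsIso.of_isIso_comp_right _
    (compareMap adj adjA adjB (N ⊙ᵣ b))
  exact isIso_of_reflects_iso _ R

lemma compareMap_linear (N : M) :
    baseChangeSmul adj adjA adjB ((toMod adjB).obj N) ≫ compareMap adj adjA adjB N =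
      RA.obj m ◁ compareMap adj adjA adjB N ≫ internalComp adjA N := by
  obtain ⟨s, hs⟩ : ∃ s : RA.obj m ⊗ R.obj (RB.obj N) ⟶ R.obj (RB.obj N),
    s = baseChangeSmul adj adjA adjB ((toMod adjB).obj N) := ⟨_, rfl⟩
  have h1 : F.map s ≫ counitHom adj (RB.obj N) = OplaxMonoidal.δ F _ _ ≫
      (compareHom adjA adjB m ⊗ₘ counitHom adj (RB.obj N)) ≫ internalComp adjB N := by
    rw [hs]
    exact baseChangeSmul_spec adj adjA adjB ((toMod adjB).obj N)
  suffices h : s ≫ compareMap adj adjA adjB N =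
      RA.obj m ◁ compareMap adj adjA adjB N ≫ internalComp adjA N by
    rw [hs] at h
    exact h
  apply internalHom_ext adjA
  have h2 : m ⊴ᵣ compareHom adjA adjB m ≫ evB adjB m = evHom adjA m :=
    compareHom_spec adjA adjB m
  have h3 : m ⊴ᵣ internalComp adjB N ≫ evB adjB N =
      (αᵣ m (RB.obj m) (RB.obj N)).hom ≫ evB adjB m ⊵ᵣ RB.obj N ≫ evB adjB N := by
    rw [← actAssoc_id]
    exact internalComp_spec adjB N
  rw [map_comp_spec, map_comp_spec, internalComp_spec, compareMap_spec,
    reassoc_of% (actAssoc_naturality_right (F := F)), MonoidalRightAction.action_exchange_assoc,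
    compareMap_spec, ← MonoidalRightAction.actionHomRight_comp_assoc]
  refine (congrArg (fun t => m ⊴ᵣ t ≫ evB adjB N) h1).trans ?_
  rw [MonoidalRightAction.actionHomRight_comp_assoc, MonoidalRightAction.actionHomRight_comp_assoc,
    h3, ← h2]
  simp only [actAssoc, MonoidalCategory.tensorHom_def, MonoidalRightAction.actionHomRight_comp,
    MonoidalRightAction.comp_actionHomLeft, Category.assoc]
  simp [← MonoidalRightAction.action_exchange_assoc]

/-- The canonical isomorphism `R(Hom_B(m, N)) ≅ Hom_A(m, N)`. -/
noncomputable def compareMapIso (N : M) : R.obj (RB.obj N) ≅ RA.obj N :=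
  asIso (compareMap adj adjA adjB N)

/-- The functor `R(Hom_B(m, -))` and the functor `Hom_A(m, -)` agree as functors to
`End_A(m)`-modules. -/
noncomputable def baseChangeCompIso : toMod adjB ⋙ baseChange adj adjA adjB ≅ toMod adjA :=
  NatIso.ofComponents
    (fun N => modIsoMk (X := (toMod adjB ⋙ baseChange adj adjA adjB).obj N)
      (Y := (toMod adjA).obj N) (compareMapIso adj adjA adjB N)
      (compareMap_linear adj adjA adjB N))
    (fun {N N'} f => by
      ext
      exact compareMap_naturality adj adjA adjB f)

lemma rhoMap_compareHom :
    F.map (rhoMap adj adjA) ≫ compareHom adjA adjB m =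
      counitHom adj (𝟙_ B) ≫ internalId adjB := by
  apply homB_ext adjB
  have h2 : m ⊴ᵣ compareHom adjA adjB m ≫ evB adjB m = evHom adjA m :=
    compareHom_spec adjA adjB m
  have h3 : m ⊴ᵣ internalId adjB ≫ evB adjB m = (ρᵣ m).hom := by
    rw [← actUnit_id]
    exact internalId_spec adjB
  rw [MonoidalRightAction.actionHomRight_comp, Category.assoc, h2, rhoMap_spec,
    MonoidalRightAction.actionHomRight_comp, Category.assoc]
  exact congrArg _ h3.symm

/-- Restricting the `End_A(m)`-action on `R(X)` along `ρ` gives the canonical `E`-action. -/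
lemma rhoMap_baseChangeSmul (X : Mod B (endAlg adjB).X) :
    rhoMap adj adjA ▷ R.obj X.X ≫ baseChangeSmul adj adjA adjB X = internalComp adj X.X := by
  obtain ⟨s, hs⟩ : ∃ s : RA.obj m ⊗ R.obj X.X ⟶ R.obj X.X,
    s = baseChangeSmul adj adjA adjB X := ⟨_, rfl⟩
  obtain ⟨x, hx⟩ : ∃ x : RB.obj m ⊗ X.X ⟶ X.X, x = γ[(endAlg adjB).X, X.X] := ⟨_, rfl⟩
  have hs1 : F.map s ≫ counitHom adj X.X = OplaxMonoidal.δ F _ _ ≫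
      (compareHom adjA adjB m ⊗ₘ counitHom adj X.X) ≫ x := by
    rw [hs, hx]
    exact baseChangeSmul_spec adj adjA adjB X
  have h : internalId adjB ▷ X.X ≫ x = (λ_ X.X).hom := by
    rw [hx]
    exact ModObj.one_smul_self (endAlg adjB).X X.X
  suffices hsuff : rhoMap adj adjA ▷ R.obj X.X ≫ s = internalComp adj X.X by
    rw [hs] at hsuff
    exact hsuff
  apply homToRight_ext adj
  have h2 : F.map (rhoMap adj adjA) ▷ F.obj (R.obj X.X) ≫
      (compareHom adjA adjB m ⊗ₘ counitHom adj X.X) =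
      (counitHom adj (𝟙_ B) ⊗ₘ counitHom adj X.X) ≫ internalId adjB ▷ X.X := by
    rw [MonoidalCategory.tensorHom_def, ← comp_whiskerRight_assoc, rhoMap_compareHom,
      comp_whiskerRight, Category.assoc, MonoidalCategory.tensorHom_def, Category.assoc,
      whisker_exchange]
  rw [F.map_comp, Category.assoc, internalComp_counit, hs1,
    ← OplaxMonoidal.δ_natural_left_assoc, reassoc_of% h2, h]

/-- The structure of a `B`-linear functor on `Hom_B(m, -)`. -/
@[reducible]
noncomputable def toModRightLinear (hT : ∀ (N : M) (b : B), IsIso (tensorHomB adjB N b)) :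
    (toMod adjB).RightLinear B :=
  rightLinearOfLax (toMod adjB)
    { μᵣ N b := Mod.Hom.mk' (M := (toMod adjB).obj N ⊙ᵣ b) (N := (toMod adjB).obj (N ⊙ᵣ b))
        (tensorHomB adjB N b) (by
          have h := tensorHomMap_linear adjB N b
          rw [← Iso.inv_comp_eq] at h
          exact (Category.assoc _ _ _).trans h)
      μᵣ_naturality_right N {b c} f := by
        ext
        exact tensorHomMap_naturality_right adjB N f
      μᵣ_naturality_left f b := by
        ext
        exact tensorHomMap_naturality_left adjB f b
      μᵣ_associativity N b c := by
        ext
        exact tensorHomB_assoc adjB N b c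
      μᵣ_unitality N := by
        ext
        exact (tensorHomB_unit adjB N).symm }
    (fun N b => isIso_of_isIso_hom _ (hT N b))

end CompareMonoidal

/-! ### The relative tensor product as an action on modules -/

section Exchange

variable {A : Type u₁} [Category.{v} A] [MonoidalCategory A]
  {B : Type u₂} [Category.{v} B] [MonoidalCategory B] {F : A ⥤ B} [F.Monoidal]
  {M : Type u₃} [Category.{v} M] [MonoidalRightAction B M]
  {R : B ⥤ A} (adj : act F (𝟙_ B) ⊣ R) {m : M} {RA : M ⥤ A} (adjA : act F m ⊣ RA)

/-- The `End_A(m)`-action on a module, with `End_A(m)` written as `RA(m)`. -/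
def endSmul (X : Mod A (endAlg adjA).X) : RA.obj m ⊗ X.X ⟶ X.X := γ[(endAlg adjA).X, X.X]

variable [∀ a : A, IsIso (unitTensorHom adj a)] [∀ a : A, IsIso (tensorUnitHom adj a)]

/-- The exchange isomorphism `a ⊗ E ≅ R(F(a)) ≅ E ⊗ a`. -/
noncomputable def exchangeIso (a : A) : a ⊗ R.obj (𝟙_ B) ≅ R.obj (𝟙_ B) ⊗ a :=
  asIso (tensorUnitHom adj a) ≪≫ (asIso (unitTensorHom adj a)).symm

lemma exchangeIso_hom_comp (a : A) :
    (exchangeIso adj a).hom ≫ unitTensorHom adj a = tensorUnitHom adj a := by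
  simp [exchangeIso]

lemma exchangeIso_naturality {a a' : A} (f : a ⟶ a') :
    f ▷ R.obj (𝟙_ B) ≫ (exchangeIso adj a').hom =
      (exchangeIso adj a).hom ≫ R.obj (𝟙_ B) ◁ f := by
  rw [← cancel_mono (unitTensorHom adj a'), Category.assoc, Category.assoc, exchangeIso_hom_comp,
    unitTensorHom_naturality, reassoc_of% (exchangeIso_hom_comp adj), tensorUnitHom_naturality]

/-- The right `E`-action on an `End_A(m)`-module `X`: the left action by restriction along `ρ`,
transported through the exchange isomorphism. -/
noncomputable def rightUnitAction (X : Mod A (endAlg adjA).X) : X.X ⊗ R.obj (𝟙_ B) ⟶ X.X :=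
  (exchangeIso adj X.X).hom ≫ rhoMap adj adjA ▷ X.X ≫ endSmul adjA X

lemma rightUnitAction_naturality {X Y : Mod A (endAlg adjA).X} (f : X ⟶ Y) :
    f.hom ▷ R.obj (𝟙_ B) ≫ rightUnitAction adj adjA Y = rightUnitAction adj adjA X ≫ f.hom := by
  have h : endSmul adjA X ≫ f.hom = RA.obj m ◁ f.hom ≫ endSmul adjA Y := modHom_linear f
  rw [rightUnitAction, rightUnitAction, reassoc_of% (exchangeIso_naturality adj),
    whisker_exchange_assoc, Category.assoc, Category.assoc, h]

lemma rightUnitAction_toMod (N : M) :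
    rightUnitAction adj adjA ((toMod adjA).obj N) = unitAction adj adjA N := by
  rw [← tensorUnitHom_comp, ← exchangeIso_hom_comp, Category.assoc, unitTensorHom_comp]
  rfl

end Exchange

section ModuleTensor

variable {A : Type u₁} [Category.{v} A] [MonoidalCategory A]
  {B : Type u₂} [Category.{v} B] [MonoidalCategory B] {F : A ⥤ B} [F.Monoidal]
  {M : Type u₃} [Category.{v} M] [MonoidalRightAction B M]
  {R : B ⥤ A} (adj : act F (𝟙_ B) ⊣ R) {m : M} {RA : M ⥤ A} (adjA : act F m ⊣ RA)
  [(toMod adjA).IsEquivalence]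

/-- The object of `M` corresponding to an `End_A(m)`-module. -/
noncomputable def ofMod (X : Mod A (endAlg adjA).X) : M := (toMod adjA).asEquivalence.inverse.obj X

/-- The morphism of `M` corresponding to a morphism of `End_A(m)`-modules. -/
noncomputable def ofModMap {X Y : Mod A (endAlg adjA).X} (f : X ⟶ Y) :
    ofMod adjA X ⟶ ofMod adjA Y :=
  (toMod adjA).asEquivalence.inverse.map f

/-- The object of `M` corresponding to the module `Hom_A(m, N)` is `N`. -/
noncomputable def ofModToMod (N : M) : ofMod adjA ((toMod adjA).obj N) ≅ N :=
  ((toMod adjA).asEquivalence.unitIso.app N).symm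

/-- An `End_A(m)`-module `X` is of the form `Hom_A(m, N)`. -/
noncomputable def toModOfMod (X : Mod A (endAlg adjA).X) :
    X ≅ (toMod adjA).obj (ofMod adjA X) :=
  ((toMod adjA).asEquivalence.counitIso.app X).symm

lemma toModOfMod_naturality {X Y : Mod A (endAlg adjA).X} (f : X ⟶ Y) :
    f ≫ (toModOfMod adjA Y).hom =
      (toModOfMod adjA X).hom ≫ (toMod adjA).map (ofModMap adjA f) :=
  (toMod adjA).asEquivalence.counitInv.naturality f

lemma toModOfMod_toMod (N : M) :
    (toModOfMod adjA ((toMod adjA).obj N)).hom =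
      (toMod adjA).map (ofModToMod adjA N).inv :=
  (toMod adjA).asEquivalence.counitInv_app_functor N

/-- The morphism of `A` underlying `toModOfMod`. -/
noncomputable def ofModHom (X : Mod A (endAlg adjA).X) : X.X ⟶ RA.obj (ofMod adjA X) :=
  (toModOfMod adjA X).hom.hom

instance (X : Mod A (endAlg adjA).X) : IsIso (ofModHom adjA X) :=
  isIso_modHom_hom (toModOfMod adjA X).hom

lemma ofModHom_linear (X : Mod A (endAlg adjA).X) :
    endSmul adjA X ≫ ofModHom adjA X =
      RA.obj m ◁ ofModHom adjA X ≫ internalComp adjA (ofMod adjA X) :=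
  modHom_linear (toModOfMod adjA X).hom

/-- The canonical morphism `X ⊗ R(b) ⟶ Hom_A(m, N ⊙ᵣ b)`, for an `End_A(m)`-module
`X ≅ Hom_A(m, N)`. -/
noncomputable def modTensorMap (X : Mod A (endAlg adjA).X) (b : B) :
    X.X ⊗ R.obj b ⟶ RA.obj (ofMod adjA X ⊙ᵣ b) :=
  ofModHom adjA X ▷ R.obj b ≫ relMap adj adjA (ofMod adjA X) b

lemma modTensorMap_linear (X : Mod A (endAlg adjA).X) (b : B) :
    endSmul adjA X ▷ R.obj b ≫ modTensorMap adj adjA X b =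
      (α_ _ _ _).hom ≫ RA.obj m ◁ modTensorMap adj adjA X b ≫
        internalComp adjA (ofMod adjA X ⊙ᵣ b) := by
  rw [modTensorMap, ← comp_whiskerRight_assoc, ofModHom_linear, comp_whiskerRight_assoc,
    relMap_linear]
  simp

lemma modTensorMap_naturality {X Y : Mod A (endAlg adjA).X} {b c : B} (f : X ⟶ Y) (g : b ⟶ c) :
    (f.hom ⊗ₘ R.map g) ≫ modTensorMap adj adjA Y c =
      modTensorMap adj adjA X b ≫ RA.map (ofModMap adjA f ⊵ᵣ b) ≫
        RA.map (ofMod adjA Y ⊴ᵣ g) := by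
  have h : f.hom ≫ ofModHom adjA Y =
      ofModHom adjA X ≫ RA.map (ofModMap adjA f) :=
    congrArg Mod.Hom.hom (toModOfMod_naturality adjA f)
  rw [MonoidalCategory.tensorHom_def, modTensorMap, Category.assoc, whisker_exchange_assoc,
    relMap_naturality_right, ← comp_whiskerRight_assoc, h, comp_whiskerRight_assoc, modTensorMap,
    Category.assoc, reassoc_of% (relMap_naturality_left adj adjA)]

lemma modTensorMap_toMod (N : M) (b : B) :
    modTensorMap adj adjA ((toMod adjA).obj N) b ≫
      RA.map ((ofModToMod adjA N).hom ⊵ᵣ b) = relMap adj adjA N b := by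
  have h : ofModHom adjA ((toMod adjA).obj N) =
      RA.map (ofModToMod adjA N).inv :=
    congrArg Mod.Hom.hom (toModOfMod_toMod adjA N)
  have h2 : RA.map (ofModToMod adjA N).inv ▷ R.obj b ≫ relMap adj adjA _ b ≫
      RA.map ((ofModToMod adjA N).hom ⊵ᵣ b) = relMap adj adjA N b := by
    rw [reassoc_of% (relMap_naturality_left adj adjA), ← RA.map_comp,
      ← MonoidalRightAction.comp_actionHomLeft, Iso.inv_hom_id]
    simp
  rw [modTensorMap, h, Category.assoc]
  exact h2

lemma isCoequalizer_modTensorMap [∀ a : A, IsIso (unitTensorHom adj a)]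
    [∀ a : A, IsIso (tensorUnitHom adj a)] (X : Mod A (endAlg adjA).X) (b : B)
    (h : IsCoequalizer (unitAction adj adjA (ofMod adjA X) ▷ R.obj b)
      ((α_ (RA.obj (ofMod adjA X)) (R.obj (𝟙_ B)) (R.obj b)).hom ≫
        RA.obj (ofMod adjA X) ◁ internalComp adj b)
      (relMap adj adjA (ofMod adjA X) b)) :
    IsCoequalizer (rightUnitAction adj adjA X ▷ R.obj b)
      ((α_ X.X (R.obj (𝟙_ B)) (R.obj b)).hom ≫ X.X ◁ internalComp adj b)
      (modTensorMap adj adjA X b) := by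
  have hX : ofModHom adjA X ▷ R.obj (𝟙_ B) ≫ unitAction adj adjA (ofMod adjA X) =
      rightUnitAction adj adjA X ≫ ofModHom adjA X := by
    rw [← rightUnitAction_toMod]
    exact rightUnitAction_naturality adj adjA (toModOfMod adjA X).hom
  refine h.of_iso ((ofModHom adjA X ▷ R.obj (𝟙_ B)) ▷ R.obj b) inferInstance
    (ofModHom adjA X ▷ R.obj b) inferInstance (𝟙 _) inferInstance ?_ ?_ ?_
  · rw [← comp_whiskerRight, ← comp_whiskerRight, hX]
  · rw [Category.assoc, whisker_exchange]
    simp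
  · rw [Category.comp_id, modTensorMap]

end ModuleTensor

section BaseChangeLinear

variable {A : Type u₁} [Category.{v} A] [MonoidalCategory A]
  {B : Type u₂} [Category.{v} B] [MonoidalCategory B] {F : A ⥤ B} [F.Monoidal]
  {M : Type u₃} [Category.{v} M] [MonoidalRightAction B M]
  {R : B ⥤ A} (adj : act F (𝟙_ B) ⊣ R) {m : M} {RA : M ⥤ A} (adjA : act F m ⊣ RA)
  {RB : M ⥤ B} (adjB : act (𝟭 B) m ⊣ RB)

/-- For an action of `B` on `End_A(m)`-modules given by relative tensor products `π`, the linear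
structure induced on `End_B(m)-mod ⥤ End_A(m)-mod` by those of `Hom_B(m, -)` and `Hom_A(m, -)`
corresponds to the canonical morphisms `R(X) ⊗ R(b) ⟶ R(X ⊗ b)`. -/
lemma comp_lineatorOfComp_baseChange [MonoidalRightAction B (Mod A (endAlg adjA).X)]
    (π : ∀ (X : Mod A (endAlg adjA).X) (b : B), X.X ⊗ R.obj b ⟶ (X ⊙ᵣ b).X)
    (hπ : ∀ {X Y : Mod A (endAlg adjA).X} (f : X ⟶ Y) (b : B),
      f.hom ▷ R.obj b ≫ π Y b = π X b ≫ (f ⊵ᵣ b).hom)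
    [(toMod adjA).RightLinear B]
    (hμA : ∀ (N : M) (b : B),
      π ((toMod adjA).obj N) b ≫ (LaxRightLinear.μᵣ (toMod adjA) N b).hom = relMap adj adjA N b)
    [(toMod adjB).RightLinear B]
    (hμB : ∀ (N : M) (b : B), (LaxRightLinear.μᵣ (toMod adjB) N b).hom = tensorHomB adjB N b)
    [(toMod adjB).IsEquivalence] (X : Mod B (endAlg adjB).X) (b : B) :
    π ((baseChange adj adjA adjB).obj X) b ≫
      (lineatorOfComp (baseChangeCompIso adj adjA adjB) X b).hom = relMap adj adj X.X b := by
  let N := (toMod adjB).objPreimage X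
  let i : X ≅ (toMod adjB).obj N := ((toMod adjB).objObjPreimageIso X).symm
  let e := baseChangeCompIso adj adjA adjB
  obtain ⟨j, hj⟩ : ∃ j : X.X ⟶ RB.obj N, j = i.hom.hom := ⟨_, rfl⟩
  have hj_iso : IsIso j := by
    rw [hj]
    exact isIso_modHom_hom i.hom
  -- the structure maps, with sources and targets expressed through `R`, `RA` and `RB`
  obtain ⟨p, hp⟩ : ∃ p : R.obj X.X ⊗ R.obj b ⟶ ((baseChange adj adjA adjB).obj X ⊙ᵣ b).X,
    p = π ((baseChange adj adjA adjB).obj X) b := ⟨_, rfl⟩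
  obtain ⟨p', hp'⟩ : ∃ p' : R.obj (RB.obj N) ⊗ R.obj b ⟶
      ((baseChange adj adjA adjB).obj ((toMod adjB).obj N) ⊙ᵣ b).X,
    p' = π ((baseChange adj adjA adjB).obj ((toMod adjB).obj N)) b := ⟨_, rfl⟩
  obtain ⟨p'', hp''⟩ : ∃ p'' : RA.obj N ⊗ R.obj b ⟶ ((toMod adjA).obj N ⊙ᵣ b).X,
    p'' = π ((toMod adjA).obj N) b := ⟨_, rfl⟩
  obtain ⟨l, hl⟩ : ∃ l : ((baseChange adj adjA adjB).obj X ⊙ᵣ b).X ⟶ R.obj (X.X ⊗ b),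
    l = (lineatorOfComp e X b).hom := ⟨_, rfl⟩
  obtain ⟨μA, hμA'⟩ : ∃ μA : ((toMod adjA).obj N ⊙ᵣ b).X ⟶ RA.obj (N ⊙ᵣ b),
    μA = (LaxRightLinear.μᵣ (toMod adjA) N b).hom := ⟨_, rfl⟩
  obtain ⟨δ, hδ⟩ : ∃ δ : RB.obj (N ⊙ᵣ b) ⟶ RB.obj N ⊗ b,
    δ = (OplaxRightLinear.δᵣ (toMod adjB) N b).hom := ⟨_, rfl⟩
  obtain ⟨r, hr⟩ : ∃ r : RA.obj (N ⊙ᵣ b) ⟶ R.obj (RB.obj (N ⊙ᵣ b)),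
    r = (e.inv.app (N ⊙ᵣ b)).hom := ⟨_, rfl⟩
  have h1 : l ≫ R.map (j ▷ b) =
      ((baseChange adj adjA adjB).map i.hom ⊵ᵣ b).hom ≫ (e.hom.app N ⊵ᵣ b).hom ≫
        μA ≫ r ≫ R.map δ := by
    rw [hl, hj, hδ, hμA', hr]
    exact (congrArg Mod.Hom.hom (lineatorOfComp_naturality_image e i.hom b)).symm
  have h2 : p ≫ ((baseChange adj adjA adjB).map i.hom ⊵ᵣ b).hom = R.map j ▷ R.obj b ≫ p' := by
    rw [hj, hp, hp']
    exact (hπ _ b).symm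
  have h3 : p' ≫ (e.hom.app N ⊵ᵣ b).hom = compareMap adj adjA adjB N ▷ R.obj b ≫ p'' := by
    rw [hp', hp'']
    exact (hπ (e.hom.app N) b).symm
  have h4 : compareMap adj adjA adjB (N ⊙ᵣ b) ≫ r = 𝟙 _ := by
    rw [hr]
    exact congrArg Mod.Hom.hom (e.hom_inv_id_app (N ⊙ᵣ b))
  have h5 : tensorHomB adjB N b ≫ δ = 𝟙 _ := by
    rw [hδ, ← hμB]
    exact congrArg Mod.Hom.hom (RightLinear.μᵣ_comp_δᵣ (F := toMod adjB) N b)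
  have h6 : p'' ≫ μA = relMap adj adjA N b := by
    rw [hp'', hμA']
    exact hμA N b
  have h7 : R.map j ▷ R.obj b ≫ relMap adj adj (RB.obj N) b =
      relMap adj adj X.X b ≫ R.map (j ▷ b) :=
    relMap_naturality_left adj adj j b
  suffices h : p ≫ l = relMap adj adj X.X b by
    rw [hp, hl] at h
    exact h
  rw [← cancel_mono (R.map (j ▷ b))]
  refine Eq.trans ?_ h7
  rw [Category.assoc, h1, reassoc_of% h2, reassoc_of% h3, reassoc_of% h6,
    reassoc_of% (compareMap_relMap adj adjA adjB), reassoc_of% h4, ← R.map_comp, h5]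
  simp

end BaseChangeLinear

/-! ### Progenerators and linearity -/

section Linear

lemma IsProgenerator.of_adjunction {C : Type u₁} [Category.{v} C] {B : Type u₂} [Category.{v} B]
    [MonoidalCategory B] {D : Type u₃} [Category.{v} D] [MonoidalRightAction B D] {F : C ⥤ B}
    {m : D} (h : IsProgenerator F m) {R : D ⥤ C} (adj : act F m ⊣ R) :
    R.ReflectsIsomorphisms ∧ PreservesColimitsOfSize.{v, v} R := by
  obtain ⟨R', adj', h1, h2⟩ := h
  let e : R' ≅ R := adj'.rightAdjointUniq adj
  exact ⟨reflectsIsomorphisms_of_iso e, preservesColimits_of_natIso e⟩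

variable {k : Type w} [Field k]

lemma linear_of_adjunction {C : Type u₁} [Category.{v} C] [Preadditive C] [Linear k C]
    {D : Type u₂} [Category.{v} D] [Preadditive D] [Linear k D] {L : C ⥤ D} {R : D ⥤ C}
    (adj : L ⊣ R) (hL : L.Linear k) : R.Linear k where
  map_smul {X Y} f r := by
    apply (adj.homEquiv _ _).symm.injective
    simp [adj.homEquiv_counit, Functor.map_smul]

variable {C : Type u₁} [Category.{v} C] [Preadditive C] [Linear k C]
  {B : Type u₂} [Category.{v} B] [Preadditive B] [Linear k B] [MonoidalCategory B]
  {D : Type u₃} [Category.{v} D] [Preadditive D] [Linear k D] [MonoidalRightAction B D]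

omit [Linear k C] in
lemma IsModulePr.act_additive (hD : IsModulePr k B D) (F : C ⥤ B) (hF : F.Additive) (m : D) :
    (act F m).Additive where
  map_add {X Y f g} := by
    simp only [act_map, F.map_add]
    exact hD.add_right m _ _

lemma IsModulePr.act_linear (hD : IsModulePr k B D) (F : C ⥤ B) (hF : F.Linear k) (m : D) :
    (act F m).Linear k where
  map_smul {X Y} f r := by
    simp only [act_map, F.map_smul]
    exact hD.smul_right m r _

lemma IsModulePr.isLinearEquivalence_toMod [MonoidalCategory C] [MonoidalPreadditive C]
    [MonoidalLinear k C] (hD : IsModulePr k B D) {F : C ⥤ B} [F.Monoidal] (hF : F.Additive)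
    (hF' : F.Linear k) {m : D} {R : D ⥤ C} (adj : act F m ⊣ R)
    (h : (toMod adj).IsEquivalence) : IsLinearEquivalence k (toMod adj) where
  isEquivalence := h
  additive := by
    have := hD.act_additive F hF m
    have hR : R.Additive := adj.right_adjoint_additive
    exact ⟨fun {X Y f g} => by ext; exact hR.map_add⟩
  linear := by
    have hR : R.Linear k := linear_of_adjunction adj (hD.act_linear F hF' m)
    exact ⟨fun {X Y} f r => by ext; exact hR.map_smul f r⟩

omit [Preadditive D] [Linear k D] in
lemma isLinearEquivalence_baseChange [MonoidalCategory C] [MonoidalPreadditive C]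
    [MonoidalLinear k C] [MonoidalPreadditive B] [MonoidalLinear k B] {F : C ⥤ B} [F.Monoidal]
    (hF : F.Additive) (hF' : F.Linear k) {R : B ⥤ C} (adj : act F (𝟙_ B) ⊣ R) {m : D}
    {RA : D ⥤ C} (adjA : act F m ⊣ RA) {RB : D ⥤ B} (adjB : act (𝟭 B) m ⊣ RB)
    (h : (baseChange adj adjA adjB).IsEquivalence) :
    IsLinearEquivalence k (baseChange adj adjA adjB) where
  isEquivalence := h
  additive := by
    have hR : R.Additive := (freeAdjunction adj).right_adjoint_additive
    exact ⟨fun {X Y f g} => by ext; exact hR.map_add⟩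
  linear := by
    have hR : R.Linear k := linear_of_adjunction (freeAdjunction adj) hF'
    exact ⟨fun {X Y} f r => by ext; exact hR.map_smul f.hom r⟩

end Linear

theorem mainTheorem9 {k : Type w} [Field k]
    {A : Type u₁} [Category.{v} A] [Preadditive A] [Linear k A] [MonoidalCategory A]
    [MonoidalPreadditive A] [MonoidalLinear k A]
    {B : Type u₂} [Category.{v} B] [Preadditive B] [Linear k B] [MonoidalCategory B]
    [MonoidalPreadditive B] [MonoidalLinear k B]
    {M : Type u₃} [Category.{v} M] [Preadditive M] [Linear k M] [MonoidalRightAction B M]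
    (hA : IsTensorPr A) (hB : IsTensorPr B) (hrigid : IsRigidPr A)
    (F : A ⥤ B) [F.Monoidal] (hF : IsTensorFunctorPr k F)
    (hunit : IsProgenerator F (𝟙_ B))
    (hM : IsModulePr k B M) (m : M) (hm : IsProgenerator F m)
    {R : B ⥤ A} (adj : act F (𝟙_ B) ⊣ R) {RA : M ⥤ A} (adjA : act F m ⊣ RA) :
    -- `ρ` is a homomorphism of algebras
    IsMonHom (rhoHom adj adjA) ∧
    -- left and right `End_A(𝟙_ B)`-modules in `A` are identified through the exchange
    -- isomorphisms `a ⊗ End_A(𝟙_ B) ≅ R(F(a)) ≅ End_A(𝟙_ B) ⊗ a`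
    (∀ a : A, IsIso (freeLeft adj a)) ∧
    ∃ σ : ∀ a : A, a ⊗ (endAlg adj).X ≅ (endAlg adj).X ⊗ a,
      (∀ a : A, (σ a).hom ≫ freeLeft adj a = freeRight adj a) ∧
      -- (1) `b` acts on `N` by the relative tensor product over `End_A(𝟙_ B)`
      (∀ (N : M) (b : B),
        IsRelativeTensor ((σ _).hom ≫ restrictedAction adj adjA ((toMod adjA).obj N))
          γ[(endAlg adj).X, ((toMod adj).obj b).X] (relMap adj adjA N b)) ∧
      -- (2) `m` is a progenerator for the action of `B`
      IsProgenerator (𝟭 B) m ∧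
      -- (3) the action of `B` on `End_A(m)-mod_A` by relative tensor product, for which
      -- `M ≃ End_A(m)-mod_A` is an equivalence of `B`-module categories
      ∃ (_ : MonoidalRightAction B (Mod A (endAlg adjA).X))
        (π : ∀ (X : Mod A (endAlg adjA).X) (b : B), X.X ⊗ R.obj b ⟶ (X ⊙ᵣ b).X)
        (LA : (toMod adjA).RightLinear B),
        (∀ (X : Mod A (endAlg adjA).X) (b : B),
          IsRelativeTensor ((σ X.X).hom ≫ restrictedAction adj adjA X)
            γ[(endAlg adj).X, ((toMod adj).obj b).X] (π X b) ∧
          γ[(endAlg adjA).X, X.X] ▷ R.obj b ≫ π X b =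
            (α_ _ _ _).hom ≫ (endAlg adjA).X ◁ π X b ≫ γ[(endAlg adjA).X, (X ⊙ᵣ b).X]) ∧
        (∀ {X Y : Mod A (endAlg adjA).X} {b c : B} (f : X ⟶ Y) (g : b ⟶ c),
          (f.hom ⊗ₘ R.map g) ≫ π Y c = π X b ≫ (f ⊙ᵣₘ g).hom) ∧
        IsLinearEquivalence k (toMod adjA) ∧
        (∀ (N : M) (b : B),
          π ((toMod adjA).obj N) b ≫ (LaxRightLinear.μᵣ (toMod adjA) N b).hom =
            relMap adj adjA N b) ∧
        -- the functor `M ≃ End_B(m)-mod_B ⥤ End_A(m)-mod_A` induced by `ρ` is an equivalence of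
        -- `B`-module categories
        ∀ {RB : M ⥤ B} (adjB : act (𝟭 B) m ⊣ RB),
          ∃ (LB : (toMod adjB).RightLinear B) (LΦ : (baseChange adj adjA adjB).RightLinear B)
            (e : toMod adjB ⋙ baseChange adj adjA adjB ≅ toMod adjA),
            IsLinearEquivalence k (toMod adjB) ∧
            (∀ (N : M) (b : B),
              (LaxRightLinear.μᵣ (toMod adjB) N b).hom = tensorHomMap adjB N b) ∧
            (∀ X : Mod B (endAlg adjB).X,
              restrictedAction adj adjA ((baseChange adj adjA adjB).obj X) =
                γ[(endAlg adj).X, ((toMod adj).obj X.X).X]) ∧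
            IsLinearEquivalence k (baseChange adj adjA adjB) ∧
            (∀ (X : Mod B (endAlg adjB).X) (b : B),
              π ((baseChange adj adjA adjB).obj X) b ≫
                (LaxRightLinear.μᵣ (baseChange adj adjA adjB) X b).hom =
              relMap adj adj X.X b) ∧
            (∀ N : M, (e.hom.app N).hom =
              curryHom adjA (m ⊴ᵣ counitHom adj (RB.obj N) ≫ evHom adjB N)) := by
  obtain ⟨hR, hRc⟩ := hunit.of_adjunction adj
  obtain ⟨hRA, hRAc⟩ := hm.of_adjunction adjA
  have := hasCoequalizers_of_isLocallyFinitelyPresentable hB.presentable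
  have := hasCoequalizers_of_isLocallyFinitelyPresentable hM.presentable
  have := preservesCoequalizers_of_cocontinuous R hRc
  have := preservesCoequalizers_of_cocontinuous RA hRAc
  have (N : M) := preservesCoequalizers_of_cocontinuous _ (hM.cocontinuous_left N)
  have (b : B) : PreservesColimitsOfShape WalkingParallelPair
      (MonoidalRightAction.actionLeft (C := B) b) :=
    preservesCoequalizers_of_cocontinuous _ (hB.cocontinuous_left b)
  have hEl (a : A) : IsIso (unitTensorHom adj a) :=
    isIso_unitTensorHom adj hA hB hrigid hF.cocontinuous hRc a
  have hEr (a : A) : IsIso (tensorUnitHom adj a) :=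
    isIso_tensorUnitHom adj hA hB hrigid hF.cocontinuous hRc a
  have hT (b : B) (a : A) : IsIso (tensorHomMap adj b a) :=
    isIso_tensorHomMap_of_isRigidPr adj hA hrigid hF.cocontinuous hRc b (hB.cocontinuous_left b) a
  have hTA (N : M) (a : A) : IsIso (tensorHomMap adjA N a) :=
    isIso_tensorHomMap_of_isRigidPr adjA hA hrigid hF.cocontinuous hRAc N
      (hM.cocontinuous_left N) a
  have hrel (N : M) (b : B) := isCoequalizer_relMap adj adjA N (hTA N) hEl b
  have hrel' (c b : B) := isCoequalizer_relMap adj adj c (hT c) hEl b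
  have hequiv := toMod_isEquivalence adjA (hTA m)
  refine ⟨isMonHom_rhoHom adj adjA, hEl, exchangeIso adj, exchangeIso_hom_comp adj,
    fun N b => ?_, ?_, ?_⟩
  · have h := hrel N b
    rw [← rightUnitAction_toMod] at h
    exact h
  · obtain ⟨RB, ⟨adjB⟩⟩ := exists_act_adjunction adj adjA (hT (𝟙_ B)) hEl
    exact ⟨RB, adjB, reflectsIsomorphisms_homB adj adjA adjB,
      cocontinuous_homB adj adjA adjB hB.presentable.toHasColimitsOfSize hRc hRAc⟩
  -- `B` acts on modules through the equivalence with `M`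
  let _ : MonoidalRightAction B (Mod A (endAlg adjA).X) :=
    transportedRightAction (toMod adjA).asEquivalence
  let _ : (toMod adjA).RightLinear B :=
    transportedRightActionRightLinear (toMod adjA).asEquivalence
  have hnat {X Y : Mod A (endAlg adjA).X} {b c : B} (f : X ⟶ Y) (g : b ⟶ c) :
      (f.hom ⊗ₘ R.map g) ≫ modTensorMap adj adjA Y c =
        modTensorMap adj adjA X b ≫ (f ⊙ᵣₘ g).hom :=
    modTensorMap_naturality adj adjA f g
  have hstr (N : M) (b : B) : modTensorMap adj adjA ((toMod adjA).obj N) b ≫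
      (LaxRightLinear.μᵣ (toMod adjA) N b).hom = relMap adj adjA N b :=
    modTensorMap_toMod adj adjA N b
  refine ⟨inferInstance, modTensorMap adj adjA, inferInstance, fun X b => ⟨?_, ?_⟩, hnat,
    hM.isLinearEquivalence_toMod hF.additive hF.linear adjA hequiv, hstr, ?_⟩
  · exact isCoequalizer_modTensorMap adj adjA X b (hrel _ b)
  · exact modTensorMap_linear adj adjA X b
  intro RB adjB
  have := reflectsIsomorphisms_homB adj adjA adjB
  have hRBc := cocontinuous_homB adj adjA adjB hB.presentable.toHasColimitsOfSize hRc hRAc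
  have := preservesCoequalizers_of_cocontinuous RB hRBc
  -- the projection formula for `B`, which need not be rigid, follows from relative tensor products
  have hTB (N : M) (b : B) : IsIso (tensorHomB adjB N b) :=
    isIso_tensorHomB adj adjA adjB N b (hrel N b) (hrel' (RB.obj N) b)
  have hequivB : (toMod adjB).IsEquivalence := toMod_isEquivalence adjB (hTB m)
  let _ : (toMod adjB).RightLinear B := toModRightLinear adjB hTB
  let e := baseChangeCompIso adj adjA adjB
  have hcomp : (toMod adjB ⋙ baseChange adj adjA adjB).IsEquivalence :=
    isEquivalence_of_iso e.symm
  have hequivΦ : (baseChange adj adjA adjB).IsEquivalence :=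
    isEquivalence_of_comp_left (toMod adjB) _
  refine ⟨inferInstance, rightLinearOfComp e, e,
    hM.isLinearEquivalence_toMod inferInstance inferInstance adjB hequivB, fun _ _ => rfl,
    rhoMap_baseChangeSmul adj adjA adjB,
    isLinearEquivalence_baseChange hF.additive hF.linear adj adjA adjB hequivΦ, ?_, fun _ => rfl⟩
  refine comp_lineatorOfComp_baseChange adj adjA adjB (modTensorMap adj adjA) (fun f b => ?_) hstr
    (fun _ _ => rfl)
  have h := hnat f (𝟙 b)
  simp only [R.map_id, tensorHom_id, MonoidalRightAction.actionHom_id] at h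
  exact h
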